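/- Let $p$ be a prime and let $G$ be a finite $p$-solvable group, i.e. a finite group each of whose chief factors is a $p$-group or a $p'$-group. Let $\mathscr{U}_p$ be the class of finite $p$-supersolvable groups, i.e. of finite groups each of whose chief factors either has order $p$ or is a $p'$-group. For a finite group $X$ let $X^{\mathscr{U}_p}$ be the intersection of all normal subgroups $N$ of $X$ with $X/N\in\mathscr{U}_p$, and put $$N_{\mathscr{U}_p}(X)=\bigcap_{T\le X}N_X\bigl(T^{\mathscr{U}_p}\bigr).$$ Define $N^0_{\mathscr{U}_p}(G)=1$ and $N^{i+1}_{\mathscr{U}_p}(G)/N^{i}_{\mathscr{U}_p}(G)=N_{\mathscr{U}_p}\bigl(G/N^{i}_{\mathscr{U}_p}(G)\bigr)$ for $i\ge 0$, and let $N^\infty_{\mathscr{U}_p}(G)$ be the terminal term of this ascending series. Let $F_p(X)$ denote the largest normal $p$-nilpotent subgroup of $X$ (a finite group being $p$-nilpotent if it has a normal $p'$-subgroup of $p$-power index), define $F_p^0(G)=1$ and $F_p^{i+1}(G)/F_p^i(G)=F_p(G/F_p^i(G))$ for $i\ge 0$, and let the $p$-Fitting length $h_p(G)$ be the smallest positive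 integer $n$ with $F_p^n(G)=G$. If every element of $G$ of order $p$, and, when $p=2$, also every element of $G$ of order $4$, lies in $N^\infty_{\mathscr{U}_p}(G)$, then $h_p(G)\le 3$. -/

import Mathlib

universe u

/-- `H / K` is a chief factor of `G`: both are normal in `G`, `K < H`, and no normal subgroup of `G`
lies strictly between them.  The order of `H / K` is `K.relIndex H`. -/
structure IsChiefFactor {G : Type u} [Group G] (K H : Subgroup G) : Prop where
  normal_bot : K.Normal
  normal_top : H.Normal
  lt : K < H
  eq_or_eq : ∀ L : Subgroup G, L.Normal → K ≤ L → L ≤ H → L = K ∨ L = H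

/-- A finite group is `p`-solvable if each of its chief factors is a `p`-group or a `p'`-group. -/
def IsPSolvable (p : ℕ) (G : Type u) [Group G] : Prop :=
  ∀ K H : Subgroup G, IsChiefFactor K H →
    (∃ n : ℕ, K.relIndex H = p ^ n) ∨ (K.relIndex H).Coprime p

/-- A finite group is `p`-supersolvable if each of its chief factors is a `p'`-group or has
order `p`. -/
def IsPSupersolvable (p : ℕ) (G : Type u) [Group G] : Prop :=
  ∀ K H : Subgroup G, IsChiefFactor K H →
    K.relIndex H = p ∨ (K.relIndex H).Coprime p

/-- A finite group is `p`-nilpotent if it has a normal `p`-complement: a normal `p'`-subgroup whose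
index is a power of `p`. -/
def IsPNilpotent (p : ℕ) (G : Type u) [Group G] : Prop :=
  ∃ N : Subgroup G, N.Normal ∧ (Nat.card N).Coprime p ∧ ∃ n : ℕ, N.index = p ^ n

theorem IsChiefFactor.map_equiv {G H : Type u} [Group G] [Group H] (e : G ≃* H)
    {K L : Subgroup G} (h : IsChiefFactor K L) :
    IsChiefFactor (K.map (e : G →* H)) (L.map (e : G →* H)) where
  normal_bot := h.normal_bot.map _ e.surjective
  normal_top := h.normal_top.map _ e.surjective
  lt := (Subgroup.map_lt_map_iff_of_injective e.injective).2 h.lt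
  eq_or_eq := by
    intro M hM h1 h2
    have hback : (M.comap (e : G →* H)).map (e : G →* H) = M :=
      Subgroup.map_comap_eq_self_of_surjective e.surjective M
    rcases h.eq_or_eq (M.comap (e : G →* H)) (hM.comap _) (Subgroup.map_le_iff_le_comap.1 h1)
      (by rw [← Subgroup.map_le_map_iff_of_injective (f := (e : G →* H)) e.injective, hback]
          exact h2) with h3 | h3
    · left; rw [← h3, hback]
    · right; rw [← h3, hback]

theorem IsPSupersolvable.of_equiv {p : ℕ} {G H : Type u} [Group G] [Group H] (e : G ≃* H)
    (hG : IsPSupersolvable p G) : IsPSupersolvable p H := by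
  intro K L h
  have h1 := hG _ _ (h.map_equiv e.symm)
  rwa [Subgroup.relIndex_map_map_of_injective (f := (e.symm : H →* G)) _ _ e.symm.injective] at h1

/-- A class of groups, closed under isomorphism. -/
structure GroupClass where
  mem : ∀ (G : Type u) [Group G], Prop
  of_equiv : ∀ {G H : Type u} [Group G] [Group H], (G ≃* H) → mem G → mem H

/-- The class of all finite `p`-supersolvable groups. -/
def pSupersolvableClass (p : ℕ) : GroupClass.{u} where
  mem G _ := Finite G ∧ IsPSupersolvable p G
  of_equiv e h := ⟨@Finite.of_equiv _ _ h.1 e.toEquiv, h.2.of_equiv e⟩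

namespace GroupClass

variable (F : GroupClass.{u})

/-- The `F`-residual of `G`: the intersection of all normal subgroups `N` with `G / N` in `F`. -/
def residual (G : Type u) [Group G] : Subgroup G :=
  sInf {N : Subgroup G | ∃ _ : N.Normal, F.mem (G ⧸ N)}

/-- The `F`-residual of a subgroup `T` of `G`, seen as a subgroup of `G`. -/
def residualOf {G : Type u} [Group G] (T : Subgroup G) : Subgroup G :=
  (F.residual T).map T.subtype

/-- The norm of `G` with respect to `F`: the intersection of the normalizers in `G` of the
`F`-residuals of all subgroups of `G`. -/
def norm (G : Type u) [Group G] : Subgroup G :=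
  ⨅ T : Subgroup G, Subgroup.normalizer (F.residualOf T : Set G)

theorem map_mem_residual {G H : Type u} [Group G] [Group H] (e : G ≃* H) {x : G}
    (hx : x ∈ F.residual G) : e x ∈ F.residual H := by
  refine Subgroup.mem_sInf.2 ?_
  rintro N ⟨hN, hF⟩
  have hN' : (N.comap (e : G →* H)).Normal := hN.comap _
  have hmap : (N.comap (e : G →* H)).map e = N :=
    Subgroup.map_comap_eq_self_of_surjective e.surjective N
  exact Subgroup.mem_sInf.1 hx (N.comap (e : G →* H))
    ⟨hN', F.of_equiv (QuotientGroup.congr _ _ e hmap).symm hF⟩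

theorem map_mem_residualOf {G : Type u} [Group G] (e : G ≃* G) (T : Subgroup G) {x : G}
    (hx : x ∈ F.residualOf T) : e x ∈ F.residualOf (T.map (e : G →* G)) := by
  obtain ⟨y, hy, rfl⟩ := hx
  exact ⟨e.subgroupMap T y, F.map_mem_residual _ hy, rfl⟩

theorem residualOf_map {G : Type u} [Group G] (e : G ≃* G) (T : Subgroup G) :
    F.residualOf (T.map (e : G →* G)) = (F.residualOf T).map (e : G →* G) := by
  apply le_antisymm
  · intro x hx
    refine ⟨e.symm x, ?_, e.apply_symm_apply x⟩
    have h := F.map_mem_residualOf e.symm _ hx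
    have hT : (T.map (e : G →* G)).map (e.symm : G →* G) = T := by
      ext y; simp [Subgroup.mem_map]
    rwa [hT] at h
  · rintro _ ⟨x, hx, rfl⟩
    exact F.map_mem_residualOf e T hx

instance norm_characteristic (G : Type u) [Group G] : (F.norm G).Characteristic := by
  rw [Subgroup.characteristic_iff_map_le]
  rintro e _ ⟨x, hx, rfl⟩
  refine Subgroup.mem_iInf.2 fun T => ?_
  have hT : (T.map (e.symm : G →* G)).map (e : G →* G) = T := by
    ext y; simp [Subgroup.mem_map]
  rw [← hT, F.residualOf_map]
  exact Subgroup.le_normalizer_map (e : G →* G) ⟨x, Subgroup.mem_iInf.1 hx _, rfl⟩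

/-- The series `N^0 = 1`, `N^{i+1} / N^i = norm (G / N^i)`, with the normality of its terms. -/
def normSeriesAux (G : Type u) [Group G] : ℕ → {N : Subgroup G // N.Normal}
  | 0 => ⟨⊥, inferInstance⟩
  | i + 1 =>
    let N := normSeriesAux G i
    have := N.2
    ⟨(F.norm (G ⧸ N.1)).comap (QuotientGroup.mk' N.1), inferInstance⟩

/-- The `i`-th term of the upper series of norms. -/
def normSeries (G : Type u) [Group G] (i : ℕ) : Subgroup G := (F.normSeriesAux G i).1

/-- The terminal term of the upper series of norms: the series is ascending, so in a finite group
its union is the term at which it becomes stationary. -/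
def hyperNorm (G : Type u) [Group G] : Subgroup G := ⨆ i, F.normSeries G i

end GroupClass

/-- The `p`-Fitting subgroup of a finite group: the largest normal `p`-nilpotent subgroup, that is
the subgroup generated by all normal `p`-nilpotent subgroups. -/
def pFitting (p : ℕ) (G : Type u) [Group G] : Subgroup G :=
  sSup {N : Subgroup G | N.Normal ∧ IsPNilpotent p N}

instance pFitting_normal (p : ℕ) (G : Type u) [Group G] : (pFitting p G).Normal :=
  Subgroup.sSup_normal _ fun _ h => h.1

/-- The upper `p`-Fitting series `F^0 = 1`, `F^{i+1} / F^i = pFitting (G / F^i)`, with the normality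
of its terms. -/
def pFittingSeriesAux (p : ℕ) (G : Type u) [Group G] : ℕ → {N : Subgroup G // N.Normal}
  | 0 => ⟨⊥, inferInstance⟩
  | i + 1 =>
    let N := pFittingSeriesAux p G i
    have := N.2
    ⟨(pFitting p (G ⧸ N.1)).comap (QuotientGroup.mk' N.1), inferInstance⟩

/-- The `i`-th term of the upper `p`-Fitting series. -/
def pFittingSeries (p : ℕ) (G : Type u) [Group G] (i : ℕ) : Subgroup G := (pFittingSeriesAux p G i).1

/-- The `p`-Fitting length: the smallest positive `n` at which the upper `p`-Fitting series
reaches `G`, and `⊤` if there is none. -/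
noncomputable def pFittingLength (p : ℕ) (G : Type u) [Group G] : ℕ∞ :=
  ⨅ (n : ℕ) (_ : 0 < n ∧ pFittingSeries p G n = ⊤), (n : ℕ∞)

/-! Write R for the `p`-supersolvable residual of G. It suffices that R is `p`-nilpotent: G/R is
`p`-supersolvable, the derived subgroup of a `p`-supersolvable group is `p`-nilpotent, and an
abelian group is `p`-nilpotent, so each of these three layers costs at most one step of the
`p`-Fitting series.

All three layers come from one criterion, `IsPSolvable.isPNilpotent_of_small_elements`: D is
`p`-nilpotent once D centralizes the `p`-chief factors of G below some normal E that contains the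
elements of D of order p (and 4 if p = 2). Modulo the largest normal `p'`-subgroup inside D, let P
be the largest normal `p`-subgroup in D. A `p'`-element of D centralizes E ∩ P, hence the small
elements of P, hence P by `IsPGroup.commute_of_coprime`. A Hall-Higman argument puts it in P, so it
is trivial.

For D = R, take E to be the hypernorm. Climbing the norm series reduces the hypothesis to
`IsPSolvable.residual_le_centralizer`: R centralizes each minimal normal `p`-subgroup V inside the
norm. Let C be the centralizer of V. If some supplement T of C meets V trivially, the norm condition
gives [V, T^U] ≤ V ∩ T = 1, U being the class of `p`-supersolvable groups, and T covers the quotient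
by C. Otherwise every supplement contains V. In a minimal one, T ∩ C consists of non-generators, and
a Frattini argument produces a normal `p'`-subgroup of T that must commute with V, although it
covers a chief factor just above C. -/

/-! ### Conjugacy of complements and the Frattini argument -/

open MulAction Pointwise in
theorem Subgroup.IsComplement'.exists_stabilizer_eq {G : Type u} [Group G] [Finite G] {N K : Subgroup G}
    [N.Normal] [IsMulCommutative N] (hN : (Nat.card N).Coprime N.index) (hK : N.IsComplement' K) :
    ∃ α : N.QuotientDiff, stabilizer G α = K := by
  -- K is itself a transversal of N, fixed by translation by its own elements. Hence K stabilizes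
  -- its class, and comparing orders gives equality.
  let T : N.LeftTransversal := ⟨(K : Set G), hK.symm⟩
  let q : N.QuotientDiff := Quotient.mk'' T
  refine ⟨q, ?_⟩
  have hle : K ≤ stabilizer G q := by
    intro k hk
    rw [mem_stabilizer_iff]
    change (Quotient.mk'' (MulOpposite.op k⁻¹ • T) : N.QuotientDiff) = _
    congr 1
    apply Subtype.ext
    ext x
    change x ∈ MulOpposite.op k⁻¹ • (K : Set G) ↔ x ∈ (K : Set G)
    rw [Set.mem_smul_set_iff_inv_smul_mem]
    simp only [← MulOpposite.op_inv, inv_inv, MulOpposite.smul_eq_mul_unop, MulOpposite.unop_op]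
    exact K.mul_mem_cancel_right hk
  have h1 := (Subgroup.isComplement'_stabilizer_of_coprime
    (α := q) hN).card_mul_card
  have h2 := hK.card_mul_card
  refine (Subgroup.eq_of_le_of_card_ge hle ?_).symm
  exact (Nat.eq_of_mul_eq_mul_left Nat.card_pos (h1.trans h2.symm)).le

/-- Complements to an abelian normal Hall subgroup are conjugate. -/
theorem Subgroup.IsComplement'.exists_map_conj_eq_of_isMulCommutative {G : Type u} [Group G] [Finite G]
    {N K L : Subgroup G} [N.Normal] [IsMulCommutative N] (hN : (Nat.card N).Coprime N.index)
    (hK : N.IsComplement' K) (hL : N.IsComplement' L) :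
    ∃ g : G, K.map (MulAut.conj g).toMonoidHom = L := by
  obtain ⟨α, rfl⟩ := hK.exists_stabilizer_eq hN
  obtain ⟨β, rfl⟩ := hL.exists_stabilizer_eq hN
  obtain ⟨h, rfl⟩ := Subgroup.exists_smul_eq hN α β
  exact ⟨h, (MulAction.stabilizer_smul_eq_stabilizer_map_conj (h : G) α).symm⟩

/-- Subgroups whose order is the index of a normal solvable Hall subgroup are conjugate. -/
theorem Subgroup.exists_map_conj_eq_of_card_eq_index {n : ℕ} : ∀ {G : Type u} [Group G] [Finite G]
    {N K L : Subgroup G} [N.Normal] [Group.IsSolvable N], Nat.card N = n →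
    (Nat.card N).Coprime N.index → Nat.card K = N.index → Nat.card L = N.index →
    ∃ g : G, K.map (MulAut.conj g).toMonoidHom = L := by
  induction n using Nat.strong_induction_on with
  | _ n ih =>
  intro G _ _ N K L _ _ hn hN hK hL
  have hcK : N.IsComplement' K := Subgroup.isComplement'_of_coprime
    (by rw [hK, Subgroup.card_mul_index]) (by rwa [hK])
  have hcL : N.IsComplement' L := Subgroup.isComplement'_of_coprime
    (by rw [hL, Subgroup.card_mul_index]) (by rwa [hL])
  by_cases hcomm : IsMulCommutative N
  · exact hcK.exists_map_conj_eq_of_isMulCommutative hN hcL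
  have hNbot : N ≠ ⊥ := by
    rintro rfl
    exact hcomm inferInstance
  set M : Subgroup G := ⁅N, N⁆ with hM
  have hMN : M ≤ N := Subgroup.commutator_le_self N
  have hlt : M < N := by
    refine lt_of_le_of_ne hMN fun hMN' => ?_
    have : Nontrivial N := (Subgroup.nontrivial_iff_ne_bot N).2 hNbot
    refine (Group.IsSolvable.commutator_lt_top_of_nontrivial N).ne ?_
    refine Subgroup.map_injective N.subtype_injective ?_
    rw [Subgroup.map_subtype_commutator, ← MonoidHom.range_eq_map, Subgroup.range_subtype]
    exact hMN'
  have hMcard : Nat.card M < n := by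
    rw [← hn]
    exact Set.ncard_lt_ncard (SetLike.coe_ssubset_coe.2 hlt) (Set.toFinite _)
  let f := QuotientGroup.mk' M
  have hf : Function.Surjective f := QuotientGroup.mk'_surjective M
  have hker : f.ker = M := QuotientGroup.ker_mk' M
  have hcardmap : ∀ J : Subgroup G, Nat.card J = N.index → Nat.card (J.map f) = N.index := by
    intro J hJ
    rw [← Subgroup.relIndex_ker, hker, ← Subgroup.inf_relIndex_right,
      (Subgroup.disjoint_of_coprime_natCard _).eq_bot, Subgroup.relIndex_bot_left, hJ]
    rw [hJ]
    exact hN.coprime_dvd_left (Subgroup.card_dvd_of_le hMN)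
  have hind : (N.map f).index = N.index := Subgroup.index_map_eq N hf (hker.le.trans hMN)
  have hNf : (N.map f).Normal := Subgroup.Normal.map inferInstance f hf
  have hcopf : (Nat.card (N.map f)).Coprime (N.map f).index := by
    rw [hind]
    exact hN.coprime_dvd_left (Subgroup.card_map_dvd N f)
  have hcf : IsMulCommutative (N.map f) := by
    rw [← Subgroup.commutator_self_eq_bot_iff, ← Subgroup.map_commutator, Subgroup.map_eq_bot_iff,
      hker]
  have hcomp : ∀ J : Subgroup G, Nat.card J = N.index → (N.map f).IsComplement' (J.map f) :=
    fun J hJ => Subgroup.isComplement'_of_coprime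
      (by rw [hcardmap J hJ, ← hind, Subgroup.card_mul_index]) (by rwa [hcardmap J hJ, ← hind])
  obtain ⟨g', hg'⟩ := (hcomp K hK).exists_map_conj_eq_of_isMulCommutative hcopf (hcomp L hL)
  obtain ⟨g, rfl⟩ := hf g'
  set K' := K.map (MulAut.conj g).toMonoidHom with hK'
  have hK'card : Nat.card K' = N.index := by
    rw [← hK]
    exact Nat.card_congr (K.equivMapOfInjective _ (MulAut.conj g).injective).symm.toEquiv
  have hmapeq : K'.map f = L.map f := by
    rw [← hg', hK', Subgroup.map_map, Subgroup.map_map]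
    congr 1
  have hsup : K' ⊔ M = L ⊔ M := by
    rw [← hker]
    exact Subgroup.map_eq_map_iff.1 hmapeq
  -- Modulo M the abelian case has made the two subgroups conjugate. After that conjugation both lie
  -- in J = LM, where M is a normal Hall subgroup of order smaller than N, so induction applies.
  set J := L ⊔ M with hJ
  have hLJ : L ≤ J := le_sup_left
  have hMJ : M ≤ J := le_sup_right
  have hKJ : K' ≤ J := hsup ▸ le_sup_left
  have hrel : (M.subgroupOf J).index = N.index := by
    change M.relIndex J = _
    rw [hJ, Subgroup.relIndex_sup_right, ← Subgroup.inf_relIndex_right,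
      (Subgroup.disjoint_of_coprime_natCard _).eq_bot, Subgroup.relIndex_bot_left, hL]
    rw [hL]
    exact hN.coprime_dvd_left (Subgroup.card_dvd_of_le hMN)
  have hcs : ∀ A : Subgroup G, A ≤ J → Nat.card (A.subgroupOf J) = Nat.card A := fun A hA =>
    Nat.card_congr (Subgroup.subgroupOfEquivOfLe hA).toEquiv
  have hsolM : Group.IsSolvable (M.subgroupOf J) :=
    have : Group.IsSolvable M := Group.isSolvable_of_isSolvable_injective (Subgroup.inclusion_injective hMN)
    Group.isSolvable_of_isSolvable_injective (f := (Subgroup.subgroupOfEquivOfLe hMJ).toMonoidHom)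
      (Subgroup.subgroupOfEquivOfLe hMJ).injective
  obtain ⟨j, hj⟩ := ih _ hMcard (G := J) (N := M.subgroupOf J) (K := K'.subgroupOf J)
    (L := L.subgroupOf J) (hcs M hMJ)
    (by rw [hcs M hMJ, hrel]; exact hN.coprime_dvd_left (Subgroup.card_dvd_of_le hMN))
    (by rw [hcs _ hKJ, hrel, hK'card]) (by rw [hcs _ hLJ, hrel, hL])
  refine ⟨j * g, ?_⟩
  have h3 := congrArg (Subgroup.map J.subtype) hj
  rw [Subgroup.map_subgroupOf_eq_of_le hLJ, Subgroup.map_map] at h3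
  have h4 : (J.subtype.comp (MulAut.conj j).toMonoidHom) =
      (MulAut.conj (j : G)).toMonoidHom.comp J.subtype := by
    ext x; simp [MulAut.conj_apply]
  rw [h4, ← Subgroup.map_map, Subgroup.map_subgroupOf_eq_of_le hKJ, hK', Subgroup.map_map] at h3
  rw [← h3]
  congr 1
  ext x
  simp [MulAut.conj_apply, mul_assoc]

/-- Schur-Zassenhaus with a Frattini argument. -/
theorem Subgroup.exists_sup_normalizer_eq_top {X : Type u} [Group X] [Finite X] {P R : Subgroup X}
    [P.Normal] [R.Normal] [Group.IsSolvable P] (hPR : P ≤ R) (h : (Nat.card P).Coprime (P.relIndex R)) :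
    ∃ S : Subgroup X, S ≤ R ∧ P ⊓ S = ⊥ ∧ P ⊔ S = R ∧ P ⊔ normalizer (S : Set X) = ⊤ := by
  have hcP : Nat.card (P.subgroupOf R) = Nat.card P :=
    Nat.card_congr (Subgroup.subgroupOfEquivOfLe hPR).toEquiv
  have hcop : (Nat.card (P.subgroupOf R)).Coprime (P.subgroupOf R).index := by rwa [hcP]
  obtain ⟨S, hS⟩ := Subgroup.exists_right_complement'_of_coprime hcop
  have hsol : Group.IsSolvable (P.subgroupOf R) :=
    Group.isSolvable_of_isSolvable_injective (f := (Subgroup.subgroupOfEquivOfLe hPR).toMonoidHom)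
      (Subgroup.subgroupOfEquivOfLe hPR).injective
  have hSR : S.map R.subtype ≤ R := Subgroup.map_subtype_le S
  have hsup : P ⊔ S.map R.subtype = R := by
    have := congrArg (Subgroup.map R.subtype) hS.sup_eq_top
    rwa [Subgroup.map_sup, Subgroup.map_subgroupOf_eq_of_le hPR, ← MonoidHom.range_eq_map,
      Subgroup.range_subtype] at this
  refine ⟨S.map R.subtype, hSR, ?_, hsup, ?_⟩
  · have := congrArg (Subgroup.map R.subtype) hS.disjoint.eq_bot
    rwa [Subgroup.map_inf _ _ _ R.subtype_injective, Subgroup.map_subgroupOf_eq_of_le hPR,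
      Subgroup.map_bot] at this
  · have hSi : Nat.card S = (P.subgroupOf R).index := hS.symm.index_eq_card.symm
    have hRle : R ≤ P ⊔ normalizer (S.map R.subtype : Set X) :=
      hsup.symm.le.trans (sup_le_sup_left Subgroup.le_normalizer _)
    refine eq_top_iff.2 fun x _ => ?_
    -- Conjugation by x carries S to another complement of P in R, and some r in R carries it back.
    -- So rx normalizes S, and r already lies in the join.
    let e := MulAut.conjNormal (H := R) x
    have hc : Nat.card (S.map e.toMonoidHom) = (P.subgroupOf R).index := by
      rw [← hSi]
      exact Nat.card_congr (S.equivMapOfInjective _ e.injective).symm.toEquiv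
    obtain ⟨r, hr⟩ := Subgroup.exists_map_conj_eq_of_card_eq_index rfl hcop hc hSi
    have hmem : (r : X) * x ∈ normalizer (S.map R.subtype : Set X) := by
      have h1 := congrArg (Subgroup.map R.subtype) hr
      rw [Subgroup.map_map, Subgroup.map_map] at h1
      have h4 : ((R.subtype.comp (MulAut.conj r).toMonoidHom).comp e.toMonoidHom) =
          (MulAut.conj (r * x : X)).toMonoidHom.comp R.subtype := by
        ext y; simp [MulAut.conj_apply, mul_assoc, e]
      rw [h4, ← Subgroup.map_map] at h1
      rw [Subgroup.mem_normalizer_iff]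
      intro y
      constructor
      · intro hy
        rw [← h1]
        exact ⟨y, hy, by simp [MulAut.conj_apply, mul_assoc]⟩
      · intro hy
        rw [← h1] at hy
        obtain ⟨z, hz, hzy⟩ := hy
        have : z = y := (MulAut.conj (r * x : X)).injective (by simpa [MulAut.conj_apply, mul_assoc] using hzy)
        exact this ▸ hz
    have := mul_mem (inv_mem (hRle r.2)) (le_sup_right (a := P) hmem)
    simpa using this

/-! ### Coprime action on `p`-groups -/

/-- Iterating the conjugation gives a^n x a^(-n) = x y^n. Taking n to be the order of a shows that
the order of y divides two coprime numbers. This upgrades [x, a, a] = 1 to [x, a] = 1. -/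
theorem conj_eq_self_of_coprime {G : Type u} [Group G] {a x y : G} {k : ℕ}
    (hk : (orderOf a).Coprime k) (hy : y ^ k = 1) (hxy : a * x * a⁻¹ = x * y) (hay : Commute a y) :
    y = 1 := by
  have h : ∀ n : ℕ, a ^ n * x * (a ^ n)⁻¹ = x * y ^ n := by
    intro n
    induction n with
    | zero => simp
    | succ n ih =>
      have h1 : a ^ (n + 1) * x * (a ^ (n + 1))⁻¹ = a * (a ^ n * x * (a ^ n)⁻¹) * a⁻¹ := by
        rw [pow_succ']; group
      have h2 : a * (x * y ^ n) * a⁻¹ = (a * x * a⁻¹) * (a * y ^ n * a⁻¹) := by group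
      rw [h1, ih, h2, hxy, (hay.pow_right n).eq, mul_inv_cancel_right, mul_assoc, ← pow_succ']
  have h1 := h (orderOf a)
  rw [pow_orderOf_eq_one] at h1
  have h2 : y ^ orderOf a = 1 := by simpa using h1
  have h3 : orderOf y ∣ Nat.gcd (orderOf a) k :=
    Nat.dvd_gcd (orderOf_dvd_of_pow_eq_one h2) (orderOf_dvd_of_pow_eq_one hy)
  rw [hk.gcd_eq_one] at h3
  exact orderOf_eq_one_iff.1 (Nat.dvd_one.1 h3)

theorem mul_pow_of_commute_commutator {G : Type u} [Group G] {x y c : G} (h : y * x = x * y * c)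
    (hx : Commute c x) (hy : Commute c y) (n : ℕ) :
    (x * y) ^ n = x ^ n * y ^ n * c ^ (n.choose 2) := by
  have h1 : ∀ n : ℕ, y ^ n * x = x * y ^ n * c ^ n := by
    intro n
    induction n with
    | zero => simp
    | succ n ih =>
      calc y ^ (n + 1) * x = y * (y ^ n * x) := by rw [pow_succ', mul_assoc]
        _ = (y * x) * (y ^ n * c ^ n) := by rw [ih]; simp only [mul_assoc]
        _ = x * y * (c * y ^ n) * c ^ n := by rw [h]; simp only [mul_assoc]
        _ = x * y ^ (n + 1) * c ^ (n + 1) := by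
          rw [(hy.pow_right n).eq, pow_succ', pow_succ' c]; simp only [mul_assoc]
  induction n with
  | zero => simp
  | succ n ih =>
    have h2 : Commute (c ^ n.choose 2) (x * y) := (hx.mul_right hy).pow_left _
    have h3 : Commute (c ^ n) y := hy.pow_left _
    calc (x * y) ^ (n + 1) = x ^ n * y ^ n * (c ^ n.choose 2 * (x * y)) := by
          rw [pow_succ, ih, mul_assoc]
      _ = x ^ n * (y ^ n * x) * y * c ^ n.choose 2 := by rw [h2.eq]; simp only [mul_assoc]
      _ = x ^ n * x * y ^ n * (c ^ n * y) * c ^ n.choose 2 := by rw [h1]; simp only [mul_assoc]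
      _ = x ^ (n + 1) * y ^ (n + 1) * (c ^ n * c ^ n.choose 2) := by
          rw [h3.eq, pow_succ, pow_succ]; simp only [mul_assoc]
      _ = _ := by rw [← pow_add, Nat.choose_succ_succ' n 1, Nat.choose_one_right]

/-- The subgroup generated by the commutators and the `p`-th powers. -/
def commutatorPow (p : ℕ) (Q : Type u) [Group Q] : Subgroup Q :=
  (powMonoidHom p : Abelianization Q →* Abelianization Q).range.comap Abelianization.of

theorem mem_commutatorPow {p : ℕ} {Q : Type u} [Group Q] {x : Q} :
    x ∈ commutatorPow p Q ↔ ∃ w : Q, (w ^ p)⁻¹ * x ∈ commutator Q := by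
  constructor
  · rintro ⟨z, hz⟩
    obtain ⟨w, rfl⟩ := QuotientGroup.mk_surjective z
    exact ⟨w, QuotientGroup.eq.1 hz⟩
  · rintro ⟨w, hw⟩
    exact ⟨Abelianization.of w, QuotientGroup.eq.2 hw⟩

instance commutatorPow_characteristic (p : ℕ) (Q : Type u) [Group Q] :
    (commutatorPow p Q).Characteristic := by
  rw [Subgroup.characteristic_iff_le_comap]
  intro e x hx
  obtain ⟨w, hw⟩ := mem_commutatorPow.1 hx
  refine mem_commutatorPow.2 ⟨e w, ?_⟩
  have := (Subgroup.characteristic_iff_le_comap.1 (inferInstance : (commutator Q).Characteristic)) e hw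
  simpa using this

theorem pow_mem_commutatorPow (p : ℕ) {Q : Type u} [Group Q] (x : Q) :
    x ^ p ∈ commutatorPow p Q := mem_commutatorPow.2 ⟨x, by simp⟩

theorem commutator_le_commutatorPow (p : ℕ) (Q : Type u) [Group Q] :
    commutator Q ≤ commutatorPow p Q := fun x hx => mem_commutatorPow.2 ⟨1, by simpa using hx⟩

/-- Otherwise the p-th power map is surjective on the nontrivial finite abelianization, hence
injective; but it kills an element of order p. -/
theorem IsPGroup.commutatorPow_ne_top {p : ℕ} [hp : Fact p.Prime] {Q : Type u} [Group Q] [Finite Q]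
    [Nontrivial Q] (hQ : IsPGroup p Q) : commutatorPow p Q ≠ ⊤ := by
  intro h
  have : Group.IsNilpotent Q := hQ.isNilpotent
  have : Nontrivial (Abelianization Q) := by
    refine QuotientGroup.nontrivial_iff.2 ?_
    exact (Group.IsSolvable.commutator_lt_top_of_nontrivial Q).ne
  have hA : IsPGroup p (Abelianization Q) := hQ.of_surjective Abelianization.of QuotientGroup.mk_surjective
  have hsurj : Function.Surjective (powMonoidHom p : Abelianization Q →* Abelianization Q) := by
    intro z
    obtain ⟨x, rfl⟩ := QuotientGroup.mk_surjective z
    exact (h ▸ Subgroup.mem_top x : x ∈ commutatorPow p Q)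
  have hinj := Finite.injective_iff_surjective.2 hsurj
  obtain ⟨n, hn, hc⟩ := hA.nontrivial_iff_card.1 inferInstance
  obtain ⟨z, hz⟩ := exists_prime_orderOf_dvd_card' (G := Abelianization Q) p
    (hc ▸ dvd_pow_self p hn.ne')
  have : z = 1 := hinj (by simp [← hz, pow_orderOf_eq_one])
  rw [this, orderOf_one] at hz
  exact hp.out.one_lt.ne hz

theorem le_normalizer_map_of_characteristic {G : Type u} [Group G] {P A : Subgroup G}
    (hA : A ≤ Subgroup.normalizer (P : Set G)) (M : Subgroup P) [hM : M.Characteristic] :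
    A ≤ Subgroup.normalizer (M.map P.subtype : Set G) := by
  intro a ha
  have key : ∀ b ∈ A, ∀ y ∈ M.map P.subtype, b * y * b⁻¹ ∈ M.map P.subtype := by
    rintro b hb _ ⟨y, hy, rfl⟩
    have := Subgroup.characteristic_iff_map_le.1 hM (P.normalizerMonoidHom ⟨b, hA hb⟩)
      ⟨y, hy, rfl⟩
    exact ⟨_, this, rfl⟩
  rw [Subgroup.mem_normalizer_iff]
  intro y
  refine ⟨key a ha y, fun h => ?_⟩
  have := key a⁻¹ (inv_mem ha) _ h
  simpa [mul_assoc] using this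

/-- A `p'`-group acting on a `p`-group `P` acts trivially if it centralizes all elements of order
`p` of `P` (and of order `4` if `p = 2`). -/
theorem IsPGroup.commute_of_coprime {p : ℕ} [hp : Fact p.Prime] {G : Type u} [Group G] [Finite G]
    {A : Subgroup G} (hA : (Nat.card A).Coprime p) {n : ℕ} : ∀ {P : Subgroup G}, Nat.card P = n →
    IsPGroup p P → A ≤ Subgroup.normalizer (P : Set G) →
    (∀ x ∈ P, x ^ p = 1 ∨ (p = 2 ∧ x ^ 4 = 1) → ∀ a ∈ A, Commute a x) →
    ∀ a ∈ A, ∀ x ∈ P, Commute a x := by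
  induction n using Nat.strong_induction_on with
  | _ n ih =>
  intro P hn hP hnorm h
  by_cases htriv : P = ⊥
  · rintro a - x hx
    rw [htriv, Subgroup.mem_bot] at hx
    exact hx ▸ Commute.one_right a
  have hproper : ∀ M : Subgroup G, M < P → A ≤ Subgroup.normalizer (M : Set G) →
      ∀ a ∈ A, ∀ x ∈ M, Commute a x := by
    intro M hM hAM
    refine ih (Nat.card M) ?_ rfl (hP.to_le hM.le) hAM fun x hx => h x (hM.le hx)
    rw [← hn]
    exact Set.ncard_lt_ncard (SetLike.coe_ssubset_coe.2 hM) (Set.toFinite _)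
  have hcop : ∀ a ∈ A, ∀ k, (orderOf a).Coprime (p ^ k) := fun a ha k =>
    Nat.Coprime.pow_right _ (hA.coprime_dvd_left (Subgroup.orderOf_dvd_natCard A ha))
  have hconj : ∀ a ∈ A, ∀ x ∈ P, a * x * a⁻¹ ∈ P := fun a ha x hx =>
    (Subgroup.mem_normalizer_iff.1 (hnorm ha) x).1 hx
  have htwice : (∀ a ∈ A, ∀ x ∈ P, Commute a (x⁻¹ * (a * x * a⁻¹))) →
      ∀ a ∈ A, ∀ x ∈ P, Commute a x := by
    intro hc a ha x hx
    obtain ⟨k, hk⟩ := hP ⟨_, mul_mem (inv_mem hx) (hconj a ha x hx)⟩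
    have hk' : (x⁻¹ * (a * x * a⁻¹)) ^ p ^ k = 1 := congrArg Subtype.val hk
    have := conj_eq_self_of_coprime (hcop a ha k) hk' (x := x) (by simp) (hc a ha x hx)
    rw [inv_mul_eq_one] at this
    exact (eq_mul_inv_iff_mul_eq.1 this).symm
  have hcomm : ∀ a ∈ A, ∀ x ∈ P, x⁻¹ * (a * x * a⁻¹) ∈ ⁅P, A⁆ := by
    intro a ha x hx
    have := Subgroup.commutator_mem_commutator (inv_mem hx) ha
    rwa [commutatorElement_def, inv_inv, mul_assoc, mul_assoc, ← mul_assoc a] at this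
  -- If [P, A] is proper, induction makes A centralize it, and coprimality then gives a trivial
  -- action on P. From here on [P, A] = P.
  by_cases hPA : ⁅P, A⁆ = P
  swap
  · refine htwice fun a ha x hx => hproper _ (lt_of_le_of_ne ?_ hPA)
      (Subgroup.normalizer_commutator_ge_right _ _) a ha _ (hcomm a ha x hx)
    exact Subgroup.le_normalizer_iff_commutator_le_left.1 hnorm
  have : Nontrivial P := (Subgroup.nontrivial_iff_ne_bot P).2 htriv
  set M : Subgroup G := (commutatorPow p P).map P.subtype with hM
  have hMP : M < P := by
    refine lt_of_le_of_ne (Subgroup.map_subtype_le _) fun hMP => hP.commutatorPow_ne_top ?_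
    refine Subgroup.map_injective P.subtype_injective ?_
    rw [← MonoidHom.range_eq_map, Subgroup.range_subtype]
    exact hMP
  have hAM := hproper M hMP (le_normalizer_map_of_characteristic hnorm _)
  have hPM : ⁅P, P⁆ ≤ M := by
    rw [← Subgroup.map_subtype_commutator]
    exact Subgroup.map_mono (commutator_le_commutatorPow p P)
  have hpow : ∀ x ∈ P, x ^ p ∈ M := fun x hx => ⟨⟨x, hx⟩ ^ p, pow_mem_commutatorPow p _, rfl⟩
  have hMA : ⁅M, A⁆ = ⊥ := by
    rw [Subgroup.commutator_eq_bot_iff_le_centralizer]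
    exact fun x hx => Subgroup.mem_centralizer_iff.2 fun a ha => hAM a ha x hx
  -- Three subgroups lemma: A centralizes M, which contains [P, M], so [[A, P], M] = [P, M] is
  -- trivial. Thus P has class at most 2, with central p-th powers.
  have hcen : ⁅P, M⁆ = ⊥ := by
    have h1 : ⁅⁅A, P⁆, M⁆ = ⊥ := by
      refine Subgroup.commutator_commutator_eq_bot_of_rotate ?_ ?_
      · rw [eq_bot_iff, ← hMA]
        exact Subgroup.commutator_mono
          ((Subgroup.commutator_mono le_rfl hMP.le).trans hPM) le_rfl
      · rw [hMA, Subgroup.commutator_bot_left]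
    rwa [Subgroup.commutator_comm A P, hPA] at h1
  have hcen' : ∀ m ∈ M, ∀ x ∈ P, Commute m x := fun m hm x hx =>
    (Subgroup.mem_centralizer_iff.1 (Subgroup.commutator_eq_bot_iff_le_centralizer.1 hcen hx) m hm)
  refine htwice fun a ha x hx => ?_
  set y := x⁻¹ * (a * x * a⁻¹) with hy
  have hyP : y ∈ P := mul_mem (inv_mem hx) (hconj a ha x hx)
  have hxy : a * x * a⁻¹ = x * y := by simp [hy]
  set c := (x * y)⁻¹ * (y * x) with hc
  have hcM : c ∈ M := by
    have := hPM (Subgroup.commutator_mem_commutator (inv_mem hyP) (inv_mem hx))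
    rw [commutatorElement_def] at this
    rwa [show c = y⁻¹ * x⁻¹ * y⁻¹⁻¹ * x⁻¹⁻¹ by rw [hc]; group]
  have hyx : y * x = x * y * c := (mul_inv_cancel_left _ _).symm
  -- xy is the conjugate of x by a, and a fixes x^p. The class-2 power formula will now force y to
  -- be a small element, which A centralizes by hypothesis.
  have hpowxy : (x * y) ^ p = x ^ p := by
    rw [← hxy, conj_pow, (hAM a ha _ (hpow x hx)).eq, mul_inv_cancel_right]
  have hmul := mul_pow_of_commute_commutator hyx (hcen' c hcM x hx) (hcen' c hcM y hyP)
  have hcp : c ^ p = 1 := by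
    have hconjy : y * x * y⁻¹ = x * c := by
      rw [hyx, mul_assoc x y c, ← (hcen' c hcM y hyP).eq, ← mul_assoc, mul_inv_cancel_right]
    have h2 : (x * c) ^ p = x ^ p := by
      rw [← hconjy, conj_pow, ← (hcen' _ (hpow x hx) y hyP).eq, mul_inv_cancel_right]
    rw [((hcen' c hcM x hx).symm).mul_pow] at h2
    simpa using h2
  refine h y hyP ?_ a ha
  rcases hp.out.eq_two_or_odd' with h2 | hodd
  · right
    refine ⟨h2, ?_⟩
    subst h2
    -- The exponent of c for squares would be 1, which need not vanish; for fourth powers it is 6,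
    -- which is even.
    have h4 := hmul 4
    have e1 : (x * y) ^ 4 = x ^ 4 := by
      rw [show (4 : ℕ) = 2 * 2 from rfl, pow_mul, hpowxy, ← pow_mul]
    have e2 : c ^ (Nat.choose 4 2) = 1 := by
      rw [show Nat.choose 4 2 = 2 * 3 from rfl, pow_mul, hcp, one_pow]
    rw [e1, e2] at h4
    simpa using h4
  · left
    have h4 := hmul p
    have e2 : c ^ (p.choose 2) = 1 := by
      have hp2 : 2 < p := lt_of_le_of_ne hp.out.two_le (by rintro rfl; exact absurd hodd (by decide))
      obtain ⟨k, hk⟩ := hp.out.dvd_choose_self two_ne_zero hp2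
      rw [hk, pow_mul, hcp, one_pow]
    rw [hpowxy, e2] at h4
    simpa using h4

/-! ### Modular law and transfer of chief factors -/

section Lattice

variable {G : Type u} [Group G] {A B C : Subgroup G}

/-- The modular law, with one of the subgroups normal. -/
theorem Subgroup.sup_inf_eq_of_le_of_normal [hB : B.Normal] (h : A ≤ C) : (A ⊔ B) ⊓ C = A ⊔ (B ⊓ C) := by
  refine le_antisymm ?_ (sup_le (le_inf le_sup_left h) (inf_le_inf_right _ le_sup_right))
  rintro x ⟨hx, hxC⟩
  obtain ⟨a, ha, b, hb, rfl⟩ := Subgroup.mem_sup_of_normal_right.1 hx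
  exact Subgroup.mul_mem_sup ha ⟨hb, (C.mul_mem_cancel_left (h ha)).1 hxC⟩

/-- Modulo C both subgroups lie in the centralizer of the image of D. This is what handles a factor
H = K(H ∩ N) covered by N. -/
theorem Subgroup.sup_commutator_le [hC : C.Normal] {D : Subgroup G} (hA : ⁅A, D⁆ ≤ C) (hB : ⁅B, D⁆ ≤ C) :
    ⁅A ⊔ B, D⁆ ≤ C := by
  have key : ∀ J : Subgroup G, ⁅J, D⁆ ≤ C ↔
      J ≤ (centralizer (D.map (QuotientGroup.mk' C) : Set (G ⧸ C))).comap (QuotientGroup.mk' C) := by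
    intro J
    rw [← Subgroup.map_le_iff_le_comap, ← Subgroup.commutator_eq_bot_iff_le_centralizer,
      ← Subgroup.map_commutator, Subgroup.map_eq_bot_iff, QuotientGroup.ker_mk']
  rw [key] at *
  exact sup_le hA hB

end Lattice

namespace IsChiefFactor

variable {G X : Type u} [Group G] [Group X] {K H N : Subgroup G}

theorem comap {f : G →* X} (hf : Function.Surjective f) {K H : Subgroup X} (h : IsChiefFactor K H) :
    IsChiefFactor (K.comap f) (H.comap f) where
  normal_bot := h.normal_bot.comap f
  normal_top := h.normal_top.comap f
  lt := (Subgroup.comap_lt_comap_of_surjective hf).2 h.lt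
  eq_or_eq L hL h1 h2 := by
    have hker : f.ker ≤ L := (Subgroup.ker_le_comap f K).trans h1
    have hback : (L.map f).comap f = L := Subgroup.comap_map_eq_self hker
    rcases h.eq_or_eq (L.map f) (hL.map f hf)
      (by rwa [← Subgroup.comap_le_comap_of_surjective hf, hback])
      (by rwa [← Subgroup.comap_le_comap_of_surjective hf, hback]) with h3 | h3
    · left; rw [← h3, hback]
    · right; rw [← h3, hback]

theorem map {f : G →* X} (hf : Function.Surjective f) (h : IsChiefFactor K H) (hK : f.ker ≤ K) :
    IsChiefFactor (K.map f) (H.map f) where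
  normal_bot := h.normal_bot.map f hf
  normal_top := h.normal_top.map f hf
  lt := by
    rw [← Subgroup.comap_lt_comap_of_surjective hf, Subgroup.comap_map_eq_self hK,
      Subgroup.comap_map_eq_self (hK.trans h.lt.le)]
    exact h.lt
  eq_or_eq L hL h1 h2 := by
    have hback : (L.comap f).map f = L := Subgroup.map_comap_eq_self_of_surjective hf L
    rcases h.eq_or_eq (L.comap f) (hL.comap f) (Subgroup.map_le_iff_le_comap.1 h1)
      (by rw [← Subgroup.comap_map_eq_self (hK.trans h.lt.le)]; exact Subgroup.comap_mono h2)
      with h3 | h3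
    · left; rw [← h3, hback]
    · right; rw [← h3, hback]

/-- The alternative "N avoids or covers H/K". An avoided factor moves up to HN/KN, a covered one
down to (H ∩ N)/(K ∩ N), with the same order. -/
theorem inf_le_or_le_sup (h : IsChiefFactor K H) (N : Subgroup G) [hN : N.Normal] :
    H ⊓ N ≤ K ∨ K ⊔ (H ⊓ N) = H := by
  have := h.normal_bot
  have := h.normal_top
  rcases h.eq_or_eq (K ⊔ (H ⊓ N)) inferInstance le_sup_left (sup_le h.lt.le inf_le_left) with h1 | h1
  · exact .inl (le_sup_right.trans h1.le)
  · exact .inr h1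

theorem sup [hN : N.Normal] (h : IsChiefFactor K H) (hNK : H ⊓ N ≤ K) :
    IsChiefFactor (K ⊔ N) (H ⊔ N) where
  normal_bot := have := h.normal_bot; inferInstance
  normal_top := have := h.normal_top; inferInstance
  lt := by
    refine lt_of_le_of_ne (sup_le_sup_right h.lt.le N) fun heq => h.lt.not_ge ?_
    have h1 : (K ⊔ N) ⊓ H = K ⊔ (N ⊓ H) := Subgroup.sup_inf_eq_of_le_of_normal h.lt.le
    rw [heq, inf_eq_right.2 le_sup_left, inf_comm N H] at h1
    exact h1.le.trans (sup_le le_rfl hNK)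
  eq_or_eq L hL h1 h2 := by
    have := h.normal_top
    have h3 : L = N ⊔ (H ⊓ L) := by
      rw [← Subgroup.sup_inf_eq_of_le_of_normal (le_sup_right.trans h1), sup_comm N H]
      exact (inf_eq_right.2 h2).symm
    rcases h.eq_or_eq (H ⊓ L) inferInstance (le_inf h.lt.le (le_sup_left.trans h1)) inf_le_left
      with h4 | h4
    · left; rw [h3, h4, sup_comm]
    · right; rw [h3, h4, sup_comm]

theorem sup_inf_eq [hN : N.Normal] (h : IsChiefFactor K H) (hNK : H ⊓ N ≤ K) : (K ⊔ N) ⊓ H = K := by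
  rw [Subgroup.sup_inf_eq_of_le_of_normal h.lt.le, inf_comm]
  exact sup_eq_left.2 hNK

theorem relIndex_sup [hN : N.Normal] (h : IsChiefFactor K H) (hNK : H ⊓ N ≤ K) :
    (K ⊔ N).relIndex (H ⊔ N) = K.relIndex H := by
  have := h.normal_bot
  have h1 : H ⊔ N = H ⊔ (K ⊔ N) := by rw [← sup_assoc, sup_eq_left.2 h.lt.le]
  rw [h1, Subgroup.relIndex_sup_right, ← Subgroup.inf_relIndex_right, h.sup_inf_eq hNK]

theorem inf [hN : N.Normal] (h : IsChiefFactor K H) (hNK : K ⊔ (H ⊓ N) = H) :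
    IsChiefFactor (K ⊓ N) (H ⊓ N) where
  normal_bot := have := h.normal_bot; inferInstance
  normal_top := have := h.normal_top; inferInstance
  lt := by
    refine lt_of_le_of_ne (inf_le_inf_right N h.lt.le) fun heq => h.lt.ne ?_
    rw [← hNK, ← heq, sup_eq_left.2 inf_le_left]
  eq_or_eq L hL h1 h2 := by
    have := h.normal_bot
    rcases h.eq_or_eq (K ⊔ L) inferInstance le_sup_left (sup_le h.lt.le (h2.trans inf_le_left))
      with h4 | h4
    · exact .inl (le_antisymm (le_inf (le_sup_right.trans h4.le) (h2.trans inf_le_right)) h1)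
    · refine .inr (le_antisymm h2 ?_)
      rw [← h4, sup_comm, Subgroup.sup_inf_eq_of_le_of_normal (h2.trans inf_le_right)]
      exact sup_le le_rfl h1

theorem relIndex_inf [N.Normal] (h : IsChiefFactor K H) (hNK : K ⊔ (H ⊓ N) = H) :
    (K ⊓ N).relIndex (H ⊓ N) = K.relIndex H := by
  have := h.normal_bot
  conv_rhs => rw [← hNK, sup_comm, Subgroup.relIndex_sup_right, ← Subgroup.inf_relIndex_right]
  rw [← Subgroup.inf_relIndex_right]
  congr 1
  exact le_antisymm (le_inf (inf_le_left.trans inf_le_left) inf_le_right)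
    (le_inf (le_inf inf_le_left (inf_le_right.trans inf_le_right)) inf_le_right)

theorem relIndex_comap {f : G →* X} (hf : Function.Surjective f) (K H : Subgroup X) :
    (K.comap f).relIndex (H.comap f) = K.relIndex H := by
  rw [Subgroup.relIndex_comap, Subgroup.map_comap_eq_self_of_surjective hf]

theorem relIndex_map (f : G →* X) (h : IsChiefFactor K H) (hK : f.ker ≤ K) :
    (K.map f).relIndex (H.map f) = K.relIndex H := by
  rw [Subgroup.relIndex_map_map, sup_eq_left.2 hK, sup_eq_left.2 (hK.trans h.lt.le)]

end IsChiefFactor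

/-! ### The `p`-supersolvable residual and norm under quotients -/

section Classes

variable {p : ℕ} {G X : Type u} [Group G] [Group X]

theorem IsPSolvable.of_surjective {f : G →* X} (hf : Function.Surjective f) (hG : IsPSolvable p G) :
    IsPSolvable p X := fun K H h => by
  have := hG _ _ (h.comap hf)
  rwa [IsChiefFactor.relIndex_comap hf] at this

theorem IsPSupersolvable.isPSolvable (hG : IsPSupersolvable p G) : IsPSolvable p G :=
  fun K H h => (hG K H h).imp_left fun h1 => ⟨1, by rw [h1, pow_one]⟩

theorem isPSupersolvable_iff_of_surjective {f : G →* X} (hf : Function.Surjective f) :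
    IsPSupersolvable p X ↔ ∀ K H : Subgroup G, IsChiefFactor K H → f.ker ≤ K →
      K.relIndex H = p ∨ (K.relIndex H).Coprime p := by
  constructor
  · intro hX K H h hK
    have := hX _ _ (h.map hf hK)
    rwa [h.relIndex_map f hK] at this
  · intro h K H hKH
    have := h _ _ (hKH.comap hf) (Subgroup.ker_le_comap f K)
    rwa [IsChiefFactor.relIndex_comap hf] at this

/-- The class is closed under subdirect products, so in a finite group the residual is itself one of
the subgroups being intersected. -/
theorem pSupersolvableClass_residual_chief [Finite G] {K H : Subgroup G} (h : IsChiefFactor K H)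
    (hK : (pSupersolvableClass p).residual G ≤ K) :
    K.relIndex H = p ∨ (K.relIndex H).Coprime p := by
  let Q : Subgroup G → Prop := fun N => N.Normal ∧ ∀ K H : Subgroup G, IsChiefFactor K H → N ≤ K →
      K.relIndex H = p ∨ (K.relIndex H).Coprime p
  have hQ : ∀ N : Subgroup G, Q N ↔ N ∈ {N : Subgroup G | ∃ _ : N.Normal,
      (pSupersolvableClass p).mem (G ⧸ N)} := by
    intro N
    constructor
    · rintro ⟨hN, h1⟩
      refine ⟨hN, inferInstance, ?_⟩
      rw [isPSupersolvable_iff_of_surjective (QuotientGroup.mk'_surjective N),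
        QuotientGroup.ker_mk']
      exact h1
    · rintro ⟨hN, -, h1⟩
      rw [isPSupersolvable_iff_of_surjective (QuotientGroup.mk'_surjective N),
        QuotientGroup.ker_mk'] at h1
      exact ⟨hN, h1⟩
  -- A factor avoided by M moves above M. One covered by M moves down into M; there N avoids it, and
  -- it moves above N.
  have hinf : ∀ M N : Subgroup G, Q M → Q N → Q (M ⊓ N) := by
    rintro M N ⟨hM, hM'⟩ ⟨hN, hN'⟩
    refine ⟨inferInstance, fun K H hKH hle => ?_⟩
    rcases hKH.inf_le_or_le_sup M with h1 | h1
    · rw [← hKH.relIndex_sup h1]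
      exact hM' _ _ (hKH.sup h1) le_sup_right
    · have h2 := hKH.inf h1
      have h3 : H ⊓ M ⊓ N ≤ K ⊓ M :=
        le_inf ((inf_le_inf_right N inf_le_right).trans hle) (inf_le_left.trans inf_le_right)
      rw [← hKH.relIndex_inf h1, ← h2.relIndex_sup h3]
      exact hN' _ _ (h2.sup h3) le_sup_right
  have htop : Q ⊤ := by
    refine ⟨inferInstance, fun K H hKH hle => ?_⟩
    exact absurd (hle.trans' le_top) (hKH.lt.trans_le le_top).not_ge
  obtain ⟨N, hN, hmin⟩ := (Set.toFinite {N | Q N}).exists_minimal ⟨⊤, htop⟩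
  refine hN.2 K H h (le_trans ?_ hK)
  refine le_sInf fun M hM => ?_
  exact (hmin (hinf N M hN ((hQ M).2 hM)) inf_le_left).trans inf_le_right

theorem pSupersolvableClass_residual_le_ker_iff [Finite G] {f : G →* X}
    (hf : Function.Surjective f) :
    (pSupersolvableClass p).residual G ≤ f.ker ↔ IsPSupersolvable p X := by
  constructor
  · intro h
    rw [isPSupersolvable_iff_of_surjective hf]
    exact fun K H hKH hK => pSupersolvableClass_residual_chief hKH (h.trans hK)
  · intro h
    refine sInf_le ⟨inferInstance, inferInstance, ?_⟩
    rw [isPSupersolvable_iff_of_surjective (QuotientGroup.mk'_surjective _), QuotientGroup.ker_mk',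
      ← isPSupersolvable_iff_of_surjective hf]
    exact h

instance GroupClass.residual_normal (F : GroupClass.{u}) : (F.residual G).Normal := by
  refine ⟨fun x hx g => Subgroup.mem_sInf.2 ?_⟩
  rintro N ⟨hN, hF⟩
  exact hN.conj_mem x (Subgroup.mem_sInf.1 hx N ⟨hN, hF⟩) g

theorem pSupersolvableClass_residual_map [Finite G] {f : G →* X} (hf : Function.Surjective f) :
    ((pSupersolvableClass p).residual G).map f = (pSupersolvableClass p).residual X := by
  have : Finite X := Finite.of_surjective f hf
  set R := (pSupersolvableClass p).residual G
  set S := (pSupersolvableClass p).residual X with hS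
  apply le_antisymm
  · rw [Subgroup.map_le_iff_le_comap]
    have h1 : IsPSupersolvable p (X ⧸ S) := by
      rw [← pSupersolvableClass_residual_le_ker_iff (QuotientGroup.mk'_surjective S),
        QuotientGroup.ker_mk']
    have h2 := (pSupersolvableClass_residual_le_ker_iff
      (f := (QuotientGroup.mk' S).comp f) ((QuotientGroup.mk'_surjective S).comp hf)).2 h1
    rwa [← MonoidHom.comap_ker, QuotientGroup.ker_mk'] at h2
  · have hn : (R.map f).Normal := Subgroup.Normal.map inferInstance f hf
    have h2 := (pSupersolvableClass_residual_le_ker_iff (p := p)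
      (f := (QuotientGroup.mk' (R.map f)).comp f) ((QuotientGroup.mk'_surjective _).comp hf)).1
      (by rw [← MonoidHom.comap_ker, QuotientGroup.ker_mk']; exact Subgroup.le_comap_map f R)
    rw [← pSupersolvableClass_residual_le_ker_iff (QuotientGroup.mk'_surjective _),
      QuotientGroup.ker_mk'] at h2
    exact h2

theorem pSupersolvableClass_residualOf_map [Finite G] (f : G →* X) (T : Subgroup G) :
    (pSupersolvableClass p).residualOf (T.map f) = ((pSupersolvableClass p).residualOf T).map f := by
  rw [GroupClass.residualOf, GroupClass.residualOf,
    ← pSupersolvableClass_residual_map (f.subgroupMap_surjective T), Subgroup.map_map,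
    Subgroup.map_map]
  rfl

theorem pSupersolvableClass_norm_map_le [Finite G] {f : G →* X} (hf : Function.Surjective f) :
    ((pSupersolvableClass p).norm G).map f ≤ (pSupersolvableClass p).norm X := by
  refine le_iInf fun T => ?_
  rw [← Subgroup.map_comap_eq_self_of_surjective hf T, pSupersolvableClass_residualOf_map]
  exact (Subgroup.map_mono (iInf_le _ (T.comap f))).trans (Subgroup.le_normalizer_map f)

end Classes

/-! ### The norm series and the chief factors below the hypernorm -/

namespace GroupClass

variable (F : GroupClass.{u}) (G : Type u) [Group G]

instance normSeries_normal (i : ℕ) : (F.normSeries G i).Normal := (F.normSeriesAux G i).2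

theorem normSeries_succ (i : ℕ) : F.normSeries G (i + 1) =
    (F.norm (G ⧸ F.normSeries G i)).comap (QuotientGroup.mk' (F.normSeries G i)) := rfl

theorem normSeries_le_succ (i : ℕ) : F.normSeries G i ≤ F.normSeries G (i + 1) := by
  rw [normSeries_succ]
  conv_lhs => rw [← QuotientGroup.ker_mk' (F.normSeries G i)]
  exact Subgroup.ker_le_comap _ _

theorem exists_hyperNorm_eq [Finite G] : ∃ i, F.hyperNorm G = F.normSeries G i :=
  ⟨_, WellFoundedGT.iSup_eq_monotonicSequenceLimit
    ⟨F.normSeries G, monotone_nat_of_le_succ (F.normSeries_le_succ G)⟩⟩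

instance hyperNorm_normal [Finite G] : (F.hyperNorm G).Normal := by
  obtain ⟨i, hi⟩ := F.exists_hyperNorm_eq G
  rw [hi]
  infer_instance

end GroupClass

section

variable {p : ℕ} {G X : Type u} [Group G] [Group X]

theorem exists_isChiefFactor_of_lt [Finite G] {K M : Subgroup G} (hK : K.Normal) (hM : M.Normal)
    (h : K < M) : ∃ H ≤ M, IsChiefFactor K H := by
  obtain ⟨H, ⟨hH, hKH, hHM⟩, hmin⟩ :=
    (Set.toFinite {H : Subgroup G | H.Normal ∧ K < H ∧ H ≤ M}).exists_minimal ⟨M, hM, h, le_rfl⟩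
  refine ⟨H, hHM, hK, hH, hKH, fun L hL h1 h2 => ?_⟩
  rcases h1.eq_or_lt with h3 | h3
  · exact .inl h3.symm
  · exact .inr (le_antisymm h2 (hmin ⟨hL, h3, h2.trans hHM⟩ h2))

/-- A normal subgroup inducing a `p`-group on a minimal normal `p`-subgroup centralizes it. -/
theorem IsChiefFactor.le_centralizer_of_relIndex_eq_pow [hp : Fact p.Prime] [Finite X]
    {V R : Subgroup X} (hV : IsChiefFactor ⊥ V) (hVp : IsPGroup p V) (hR : R.Normal) {n : ℕ}
    (hn : (Subgroup.centralizer (V : Set X)).relIndex R = p ^ n) :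
    R ≤ Subgroup.centralizer (V : Set X) := by
  have := hV.normal_top
  have : Nontrivial V := (Subgroup.nontrivial_iff_ne_bot V).2 hV.lt.ne'
  let φ : X →* MulAut V := MulAut.conjNormal
  have hφ : φ.ker = Subgroup.centralizer (V : Set X) := by
    ext x
    rw [MonoidHom.mem_ker, Subgroup.mem_centralizer_iff]
    constructor
    · intro h v hv
      have := congrArg Subtype.val (DFunLike.congr_fun h (⟨v, hv⟩ : V))
      rw [MulAut.conjNormal_apply, mul_inv_eq_iff_eq_mul] at this
      exact this.symm
    · intro h
      ext v
      rw [MulAut.conjNormal_apply, mul_inv_eq_iff_eq_mul]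
      exact (h v v.2).symm
  have hQ : IsPGroup p (R.map φ) := IsPGroup.of_card (n := n) (by rw [← Subgroup.relIndex_ker, hφ, hn])
  obtain ⟨k, hk, hc⟩ := hVp.nontrivial_iff_card.1 inferInstance
  -- The identity cannot be the only fixed point of a `p`-group on V. The fixed points form a
  -- nontrivial normal subgroup, hence all of V.
  obtain ⟨v, hv, hv1⟩ := hQ.exists_fixed_point_of_prime_dvd_card_of_fixed_point V
    (hc ▸ dvd_pow_self p hk.ne') (a := 1) (fun g => smul_one g)
  have hvR : (v : X) ∈ V ⊓ Subgroup.centralizer (R : Set X) := by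
    refine ⟨v.2, Subgroup.mem_centralizer_iff.2 fun r hr => ?_⟩
    have := congrArg Subtype.val (hv ⟨φ r, r, hr, rfl⟩)
    change r * v * r⁻¹ = v at this
    rwa [mul_inv_eq_iff_eq_mul] at this
  rcases hV.eq_or_eq (V ⊓ Subgroup.centralizer (R : Set X)) inferInstance bot_le inf_le_left with h | h
  · rw [h, Subgroup.mem_bot] at hvR
    exact absurd (Subtype.ext hvR.symm) hv1
  · rw [← Subgroup.commutator_eq_bot_iff_le_centralizer, Subgroup.commutator_comm,
      Subgroup.commutator_eq_bot_iff_le_centralizer]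
    exact inf_eq_left.1 h

/-- A normal subgroup `V` of the norm that avoids a supplement `T` of its centralizer is
centralized by the residual. -/
theorem residual_le_centralizer_of_inf_eq_bot [Finite X] {V T : Subgroup X} [hV : V.Normal]
    (hVN : V ≤ (pSupersolvableClass p).norm X) (hT : T ⊔ Subgroup.centralizer (V : Set X) = ⊤)
    (hVT : V ⊓ T = ⊥) :
    (pSupersolvableClass p).residual X ≤ Subgroup.centralizer (V : Set X) := by
  set C := Subgroup.centralizer (V : Set X) with hC
  have hTC : (pSupersolvableClass p).residualOf T ≤ C := by
    intro t ht
    refine Subgroup.mem_centralizer_iff.2 fun v hv => ?_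
    have hmem : v * t * v⁻¹ * t⁻¹ ∈ V ⊓ T := by
      constructor
      · have := V.mul_mem hv (hV.conj_mem _ (inv_mem hv) t)
        simpa [mul_assoc] using this
      · have hn := (Subgroup.mem_normalizer_iff.1 (Subgroup.mem_iInf.1 (hVN hv) T) t).1 ht
        exact T.mul_mem (Subgroup.map_subtype_le _ hn) (T.inv_mem (Subgroup.map_subtype_le _ ht))
    rw [hVT, Subgroup.mem_bot, mul_inv_eq_one, mul_inv_eq_iff_eq_mul] at hmem
    exact hmem
  -- T covers X/C, so its residual and that of X have the same image there, and the image of the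
  -- former is trivial.
  have hsurj : Function.Surjective ((QuotientGroup.mk' C).comp T.subtype) := by
    rw [← MonoidHom.range_eq_top, MonoidHom.range_comp, Subgroup.range_subtype,
      ← MonoidHom.range_eq_top.2 (QuotientGroup.mk'_surjective C), MonoidHom.range_eq_map,
      Subgroup.map_eq_map_iff, QuotientGroup.ker_mk', hT, top_sup_eq]
  have h1 := pSupersolvableClass_residual_map (p := p) hsurj
  rw [← Subgroup.map_map, ← pSupersolvableClass_residual_map (QuotientGroup.mk'_surjective C)] at h1
  have h2 : ((pSupersolvableClass p).residualOf T).map (QuotientGroup.mk' C) = ⊥ :=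
    (Subgroup.map_eq_bot_iff _).2 (hTC.trans_eq (QuotientGroup.ker_mk' C).symm)
  rw [← QuotientGroup.ker_mk' C, ← Subgroup.map_eq_bot_iff]
  exact h1.symm.trans h2

/-- If `D` is a normal subgroup of non-generators of `T` and `R / D` is a `p'`-group, then `R` has
a normal `p`-complement which is normal in `T`. -/
theorem exists_normal_complement_of_nongenerating {T : Type u} [Group T] [hp : Fact p.Prime]
    [Finite T] {D R : Subgroup T} [D.Normal] [R.Normal] (hDR : D ≤ R)
    (hcop : (D.relIndex R).Coprime p) (hD : ∀ S : Subgroup T, S ⊔ D = ⊤ → S = ⊤) :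
    ∃ S : Subgroup T, S.Normal ∧ (Nat.card S).Coprime p ∧ R ≤ D ⊔ S := by
  obtain ⟨P⟩ : Nonempty (Sylow p D) := inferInstance
  set Q : Subgroup T := P.map D.subtype with hQ
  have hQD : Q ≤ D := Subgroup.map_subtype_le _
  have hQn : Q.Normal := by
    rw [← Subgroup.normalizer_eq_top_iff]
    -- Frattini: the normalizer of Q supplements the non-generators in D, so it is all of T. The
    -- same device below makes the complement S normal.
    exact hD _ (Sylow.normalizer_sup_eq_top P)
  have hQp : IsPGroup p Q := P.isPGroup'.map _
  have : Group.IsNilpotent Q := hQp.isNilpotent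
  have hQrel : (Q.relIndex D).Coprime p := by
    have h1 : Q.relIndex D = (P : Subgroup D).index := by
      rw [Subgroup.relIndex, hQ, Subgroup.subgroupOf, Subgroup.comap_map_eq_self_of_injective
        D.subtype_injective]
    rw [h1]
    exact ((Nat.Prime.coprime_iff_not_dvd hp.out).2 P.not_dvd_index).symm
  have hQR : (Q.relIndex R).Coprime p := by
    rw [← Subgroup.relIndex_mul_relIndex Q D R hQD hDR]
    exact hQrel.mul_left hcop
  obtain ⟨k, hk⟩ := IsPGroup.iff_card.1 hQp
  obtain ⟨S, hSR, hQS, hsup, hN⟩ := Subgroup.exists_sup_normalizer_eq_top (hQD.trans hDR)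
    (by rw [hk]; exact (hQR.pow_right k).symm)
  refine ⟨S, ?_, ?_, hsup.symm.le.trans (sup_le_sup_right hQD S)⟩
  · rw [← Subgroup.normalizer_eq_top_iff]
    refine hD _ (eq_top_iff.2 ?_)
    rw [← hN, sup_comm]
    exact sup_le_sup_left hQD _
  · have h1 : Q.relIndex R = Nat.card S := by
      rw [← hsup, sup_comm, Subgroup.relIndex_sup_right, ← Subgroup.inf_relIndex_right, hQS,
        Subgroup.relIndex_bot_left]
    rwa [← h1]

/-- In a `p`-solvable group, a minimal normal `p`-subgroup contained in the norm is centralized by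
the residual. -/
theorem IsPSolvable.residual_le_centralizer [hp : Fact p.Prime] [Finite X] (hX : IsPSolvable p X)
    {V : Subgroup X} (hV : IsChiefFactor ⊥ V) (hVp : IsPGroup p V)
    (hVN : V ≤ (pSupersolvableClass p).norm X) :
    (pSupersolvableClass p).residual X ≤ Subgroup.centralizer (V : Set X) := by
  have hVn := hV.normal_top
  by_contra hcon
  set C := Subgroup.centralizer (V : Set X) with hC
  -- V ∩ T is normalized by T, and by C because C centralizes V. By minimality it is 1 or V, and 1
  -- is excluded by assumption.
  have hsupp : ∀ T : Subgroup X, T ⊔ C = ⊤ → V ≤ T := by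
    intro T hT
    have hn : (V ⊓ T).Normal := by
      rw [← Subgroup.normalizer_eq_top_iff, eq_top_iff, ← hT]
      refine sup_le (fun t ht => Subgroup.mem_normalizer_iff.2 fun x => ?_)
        (fun c hc => Subgroup.mem_normalizer_iff.2 fun x => ?_)
      · rw [Subgroup.mem_inf, Subgroup.mem_inf, hVn.mem_comm_iff, ← mul_assoc, inv_mul_cancel,
          one_mul, T.mul_mem_cancel_right (inv_mem ht), T.mul_mem_cancel_left ht]
      · by_cases hx : x ∈ V
        · rw [← Subgroup.mem_centralizer_iff.1 hc x hx, mul_inv_cancel_right]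
        · refine iff_of_false (fun h => hx h.1) (fun h => hx ?_)
          have : c * x * c⁻¹ ∈ V := h.1
          rwa [hVn.mem_comm_iff, ← mul_assoc, inv_mul_cancel, one_mul] at this
    rcases hV.eq_or_eq (V ⊓ T) hn bot_le inf_le_left with h | h
    · exact absurd (residual_le_centralizer_of_inf_eq_bot hVN hT h) hcon
    · exact inf_eq_left.1 h
  obtain ⟨T, hT, hmin⟩ := (Set.toFinite {T : Subgroup X | T ⊔ C = ⊤}).exists_minimal
    ⟨⊤, top_sup_eq C⟩
  have hVT := hsupp T hT
  have hCtop : C < ⊤ := lt_top_iff_ne_top.2 fun h => hcon (h ▸ le_top)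
  obtain ⟨R, -, hCR⟩ := exists_isChiefFactor_of_lt inferInstance inferInstance hCtop
  have hRn := hCR.normal_top
  rcases hX C R hCR with ⟨n, hn⟩ | hcop
  · exact hCR.lt.not_ge (hV.le_centralizer_of_relIndex_eq_pow hVp hRn hn)
  have hR : C ⊔ (T ⊓ R) = R := by
    refine le_antisymm (sup_le hCR.lt.le inf_le_right) fun x hx => ?_
    obtain ⟨t, ht, c, hc, rfl⟩ := Subgroup.mem_sup_of_normal_right.1
      (hT.symm ▸ Subgroup.mem_top x : x ∈ T ⊔ C)
    rw [sup_comm]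
    exact Subgroup.mul_mem_sup ⟨ht, (R.mul_mem_cancel_right (hCR.lt.le hc)).1 hx⟩ hc
  -- Since T is a minimal supplement, a subgroup that generates T together with C ∩ T would again
  -- supplement C.
  have hD : ∀ S : Subgroup T, S ⊔ C.subgroupOf T = ⊤ → S = ⊤ := by
    intro S hS
    have h1 : S.map T.subtype ⊔ (C.subgroupOf T).map T.subtype = T := by
      rw [← Subgroup.map_sup, hS, ← MonoidHom.range_eq_map, Subgroup.range_subtype]
    have h2 : S.map T.subtype ⊔ C = ⊤ := by
      rw [eq_top_iff, ← hT]
      refine sup_le (h1.symm.le.trans (sup_le_sup_left ?_ _)) le_sup_right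
      exact Subgroup.map_comap_le _ _
    have h3 := hmin h2 (Subgroup.map_subtype_le S)
    refine eq_top_iff.2 fun t _ => ?_
    obtain ⟨s, hs, hst⟩ := h3 t.2
    exact (Subtype.ext hst : s = t) ▸ hs
  have hrel : (C.subgroupOf T).relIndex (R.subgroupOf T) = C.relIndex R := by
    rw [Subgroup.subgroupOf, Subgroup.relIndex_comap, Subgroup.subgroupOf_map_subtype, inf_comm,
      ← Subgroup.relIndex_sup_right, sup_comm, hR]
  obtain ⟨S, hSn, hScard, hRS⟩ := exists_normal_complement_of_nongenerating (p := p)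
    (D := C.subgroupOf T) (R := R.subgroupOf T) (Subgroup.comap_mono hCR.lt.le)
    (by rwa [hrel]) hD
  have hVpT : IsPGroup p (V.subgroupOf T) := hVp.comap_subtype
  obtain ⟨k, hk⟩ := IsPGroup.iff_card.1 hVpT
  -- Here V ≤ T is essential: S and V are normal in T of coprime orders, so they commute and S ≤ C,
  -- whence R ≤ C.
  have hdisj : Disjoint S (V.subgroupOf T) :=
    Subgroup.disjoint_of_coprime_natCard (by rw [hk]; exact hScard.pow_right k)
  have hcomm := Subgroup.commutator_eq_bot_of_disjoint hdisj
  have hSC : S ≤ C.subgroupOf T := by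
    intro s hs
    refine Subgroup.mem_centralizer_iff.2 fun v hv => ?_
    have := Subgroup.commutator_eq_bot_iff_le_centralizer.1 hcomm hs
    exact congrArg Subtype.val (Subgroup.mem_centralizer_iff.1 this ⟨v, hVT hv⟩ hv)
  have hRC : R.subgroupOf T ≤ C.subgroupOf T := hRS.trans (sup_le le_rfl hSC)
  refine hCR.lt.not_ge (hR.symm.le.trans (sup_le le_rfl ?_))
  rintro x ⟨hxT, hxR⟩
  exact hRC (x := ⟨x, hxT⟩) hxR

/-- In a `p`-solvable group, the `p`-chief factors below the hypernorm are centralized by the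
residual. -/
theorem IsPSolvable.commutator_residual_le [hp : Fact p.Prime] [Finite G] (hG : IsPSolvable p G)
    {K H : Subgroup G} (h : IsChiefFactor K H) {n : ℕ} (hn : K.relIndex H = p ^ n)
    (hH : H ≤ (pSupersolvableClass p).hyperNorm G) :
    ⁅H, (pSupersolvableClass p).residual G⁆ ≤ K := by
  obtain ⟨i, hi⟩ := (pSupersolvableClass p).exists_hyperNorm_eq G
  rw [hi] at hH
  clear hi
  induction i generalizing K H with
  | zero => exact absurd (hH.trans bot_le) h.lt.not_ge
  | succ i ih =>
    set N := (pSupersolvableClass p).normSeries G i with hN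
    rcases h.inf_le_or_le_sup N with h1 | h1
    · have h2 := h.sup h1
      have hKn := h2.normal_bot
      let f := QuotientGroup.mk' (K ⊔ N)
      have hf : Function.Surjective f := QuotientGroup.mk'_surjective _
      have hker : f.ker = K ⊔ N := QuotientGroup.ker_mk' _
      have h3 := h2.map hf hker.le
      rw [(Subgroup.map_eq_bot_iff (K ⊔ N)).2 hker.ge] at h3
      have hp3 : IsPGroup p ((H ⊔ N).map f) := by
        refine IsPGroup.of_card (n := n) ?_
        rw [← Subgroup.relIndex_ker, hker, h.relIndex_sup h1, hn]
      have hle : (H ⊔ N).map f ≤ (pSupersolvableClass p).norm (G ⧸ (K ⊔ N)) := by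
        let g : G ⧸ N →* G ⧸ (K ⊔ N) := QuotientGroup.map N (K ⊔ N) (MonoidHom.id G) le_sup_right
        have hg : Function.Surjective g := by
          intro x
          obtain ⟨y, rfl⟩ := QuotientGroup.mk_surjective x
          exact ⟨y, rfl⟩
        have hfg : f = g.comp (QuotientGroup.mk' N) := rfl
        rw [hfg, ← Subgroup.map_map]
        refine (Subgroup.map_mono ?_).trans (pSupersolvableClass_norm_map_le hg)
        rw [Subgroup.map_le_iff_le_comap]
        exact sup_le hH (GroupClass.normSeries_le_succ _ G i)
      have h4 := (hG.of_surjective hf).residual_le_centralizer h3 hp3 hle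
      rw [← pSupersolvableClass_residual_map hf, ← Subgroup.commutator_eq_bot_iff_le_centralizer,
        ← Subgroup.map_commutator, Subgroup.map_eq_bot_iff, hker, Subgroup.commutator_comm] at h4
      have := h.normal_top
      rw [← h.sup_inf_eq h1]
      exact le_inf ((Subgroup.commutator_mono le_sup_left le_rfl).trans h4)
        (Subgroup.commutator_le_left _ _)
    · have h2 := ih (h.inf h1) (by rw [h.relIndex_inf h1, hn]) inf_le_right
      have := h.normal_bot
      rw [← h1]
      exact Subgroup.sup_commutator_le (Subgroup.commutator_le_left _ _) (h2.trans inf_le_left)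

end

/-! ### The `p`-nilpotency criterion -/

section

variable {p : ℕ} {G X : Type u} [Group G] [Group X]

theorem exists_isChiefFactor_of_ne_bot [Finite G] {M : Subgroup G} (hM : M.Normal)
    (h : M ≠ ⊥) : ∃ L, IsChiefFactor L M := by
  obtain ⟨L, ⟨hL, hLM⟩, hmax⟩ :=
    (Set.toFinite {L : Subgroup G | L.Normal ∧ L < M}).exists_maximal
      ⟨⊥, inferInstance, bot_lt_iff_ne_bot.2 h⟩
  refine ⟨L, hL, hM, hLM, fun J hJ h1 h2 => ?_⟩
  rcases h2.eq_or_lt with h3 | h3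
  · exact .inr h3
  · exact .inl (le_antisymm (hmax ⟨hJ, h3⟩ h1) h1)

/-- A `p'`-element of `D` centralizes every normal `p`-subgroup `M` such that `D` centralizes the
chief factors below `M`. -/
theorem commute_of_forall_commutator_le [Fact p.Prime] [Finite G] {D : Subgroup G} {a : G}
    (haD : a ∈ D) (ha : (orderOf a).Coprime p) {n : ℕ} : ∀ {M : Subgroup G}, Nat.card M = n →
    M.Normal → IsPGroup p M → (∀ K H : Subgroup G, IsChiefFactor K H → H ≤ M → ⁅H, D⁆ ≤ K) →
    ∀ x ∈ M, Commute a x := by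
  induction n using Nat.strong_induction_on with
  | _ n ih =>
  intro M hn hM hMp h x hx
  by_cases hbot : M = ⊥
  · rw [hbot, Subgroup.mem_bot] at hx
    exact hx ▸ Commute.one_right a
  obtain ⟨L, hL⟩ := exists_isChiefFactor_of_ne_bot hM hbot
  have hLa : ∀ y ∈ L, Commute a y := by
    refine ih (Nat.card L) ?_ rfl hL.normal_bot (hMp.to_le hL.lt.le)
      fun K H hKH hH => h K H hKH (hH.trans hL.lt.le)
    rw [← hn]
    exact Set.ncard_lt_ncard (SetLike.coe_ssubset_coe.2 hL.lt) (Set.toFinite _)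
  have hy : x⁻¹ * (a * x * a⁻¹) ∈ L := by
    have := h L M hL le_rfl (Subgroup.commutator_mem_commutator (inv_mem hx) haD)
    rwa [commutatorElement_def, inv_inv, mul_assoc, mul_assoc, ← mul_assoc a] at this
  obtain ⟨k, hk⟩ := hMp ⟨_, hL.lt.le hy⟩
  have hk' : (x⁻¹ * (a * x * a⁻¹)) ^ p ^ k = 1 := congrArg Subtype.val hk
  have := conj_eq_self_of_coprime (ha.pow_right k) hk' (x := x) (by simp) (hLa _ hy)
  rw [inv_mul_eq_one] at this
  exact (eq_mul_inv_iff_mul_eq.1 this).symm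

/-- A relative version of the Hall-Higman lemma: if `D` contains no normal `p'`-subgroup of `G`,
then the largest normal `p`-subgroup of `G` in `D` contains its centralizer in `D`. -/
theorem IsPSolvable.inf_centralizer_le [hp : Fact p.Prime] [Finite G] (hG : IsPSolvable p G)
    {D P : Subgroup G} [D.Normal] [hPn : P.Normal] (hPp : IsPGroup p P)
    (hP : ∀ Q : Subgroup G, Q.Normal → Q ≤ D → IsPGroup p Q → Q ≤ P)
    (hO : ∀ N : Subgroup G, N.Normal → N ≤ D → (Nat.card N).Coprime p → N = ⊥) :
    D ⊓ Subgroup.centralizer (P : Set G) ≤ P := by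
  set C := D ⊓ Subgroup.centralizer (P : Set G) with hC
  by_contra hcon
  have hlt : C ⊓ P < C := inf_lt_left.2 hcon
  -- If K/(C ∩ P) is a `p`-group then K is one too, and maximality puts it in P. If it is a
  -- `p'`-group, the central C ∩ P has a complement in K; Frattini makes it normal in G,
  -- contradicting the absence of normal `p'`-subgroups in D.
  obtain ⟨K, hKC, hK⟩ := exists_isChiefFactor_of_lt inferInstance inferInstance hlt
  have hKn := hK.normal_top
  have hZp : IsPGroup p (C ⊓ P : Subgroup G) := hPp.to_le inf_le_right
  obtain ⟨k, hk⟩ := IsPGroup.iff_card.1 hZp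
  rcases hG _ _ hK with ⟨n, hn⟩ | hcop
  · have hKp : IsPGroup p K := by
      refine IsPGroup.of_card (n := k + n) ?_
      rw [← Subgroup.relIndex_bot_left, ← Subgroup.relIndex_mul_relIndex ⊥ _ K bot_le hK.lt.le,
        Subgroup.relIndex_bot_left, hk, hn, pow_add]
    exact hK.lt.not_ge (le_inf hKC (hP K hKn (hKC.trans inf_le_left) hKp))
  · have : Group.IsNilpotent (C ⊓ P : Subgroup G) := hZp.isNilpotent
    obtain ⟨S, hSK, hZS, hsup, hN⟩ := Subgroup.exists_sup_normalizer_eq_top hK.lt.le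
      (by rw [hk]; exact (hcop.pow_right k).symm)
    have hSC := hSK.trans hKC
    have hZN : C ⊓ P ≤ Subgroup.normalizer (S : Set G) := by
      refine le_trans ?_ (Subgroup.centralizer_le_normalizer _)
      refine inf_le_right.trans ?_
      rw [← Subgroup.commutator_eq_bot_iff_le_centralizer, Subgroup.commutator_comm,
        Subgroup.commutator_eq_bot_iff_le_centralizer]
      exact hSC.trans inf_le_right
    have hSn : S.Normal := by
      rw [← Subgroup.normalizer_eq_top_iff, ← hN]
      exact (sup_eq_right.2 hZN).symm
    have hcard : Nat.card S = (C ⊓ P).relIndex K := by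
      rw [← hsup, sup_comm, Subgroup.relIndex_sup_right, ← Subgroup.inf_relIndex_right, hZS,
        Subgroup.relIndex_bot_left]
    have hS := hO S hSn (hSC.trans inf_le_left) (hcard ▸ hcop)
    rw [hS, sup_bot_eq] at hsup
    exact hK.lt.ne hsup

/-- The criterion once normal `p'`-subgroups are factored out: every `p'`-element of D centralizes
the largest normal `p`-subgroup in D, so it lies in it and is trivial. -/
theorem IsPSolvable.isPGroup_of_small_elements [hp : Fact p.Prime] [Finite G]
    (hG : IsPSolvable p G) {D E : Subgroup G} [D.Normal] [E.Normal]
    (hsmall : ∀ x ∈ D, x ^ p = 1 ∨ (p = 2 ∧ x ^ 4 = 1) → x ∈ E)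
    (hE : ∀ K H : Subgroup G, IsChiefFactor K H → H ≤ E → ∀ n, K.relIndex H = p ^ n → ⁅H, D⁆ ≤ K)
    (hO : ∀ N : Subgroup G, N.Normal → N ≤ D → (Nat.card N).Coprime p → N = ⊥) :
    IsPGroup p D := by
  obtain ⟨P, ⟨hPn, hPD, hPp⟩, hmax⟩ :=
    (Set.toFinite {P : Subgroup G | P.Normal ∧ P ≤ D ∧ IsPGroup p P}).exists_maximal
      ⟨⊥, inferInstance, bot_le, IsPGroup.of_bot⟩
  have hP : ∀ Q : Subgroup G, Q.Normal → Q ≤ D → IsPGroup p Q → Q ≤ P := fun Q hQ hQD hQp =>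
    le_sup_right.trans (hmax ⟨inferInstance, sup_le hPD hQD, hPp.to_sup_of_normal_left hQp⟩
      le_sup_left)
  have hself := hG.inf_centralizer_le hPp hP hO
  have hp' : ∀ a ∈ D, (orderOf a).Coprime p → a = 1 := by
    intro a haD ha
    have h1 : ∀ x ∈ E ⊓ P, Commute a x := by
      refine commute_of_forall_commutator_le haD ha rfl inferInstance (hPp.to_le inf_le_right) ?_
      intro K H hKH hH
      obtain ⟨m, hm⟩ := IsPGroup.iff_card.1 (hPp.to_le (hH.trans inf_le_right))
      obtain ⟨n, -, hn⟩ := (Nat.dvd_prime_pow hp.out).1 (hm ▸ Subgroup.relIndex_dvd_card K H)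
      exact hE K H hKH (hH.trans inf_le_left) n hn
    have h2 := IsPGroup.commute_of_coprime (p := p) (A := Subgroup.zpowers a) (P := P)
      (by rwa [Nat.card_zpowers]) rfl hPp
      (by rw [Subgroup.normalizer_eq_top_iff.2 hPn]; exact le_top)
      (by
        rintro x hx hxs _ ⟨k, rfl⟩
        exact (h1 x ⟨hsmall x (hPD hx) hxs, hx⟩).zpow_left k)
      a (Subgroup.mem_zpowers a)
    have h3 : a ∈ P := hself ⟨haD, Subgroup.mem_centralizer_iff.2 fun x hx => (h2 x hx).symm⟩
    obtain ⟨k, hk⟩ := hPp ⟨a, h3⟩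
    have hk' : a ^ p ^ k = 1 := congrArg Subtype.val hk
    exact orderOf_eq_one_iff.1
      (Nat.Coprime.eq_one_of_dvd (ha.pow_right k) (orderOf_dvd_of_pow_eq_one hk'))
  rintro ⟨g, hg⟩
  -- The power of g by the `p`-part of its order is a `p'`-element, hence 1.
  obtain ⟨k, m, hm, hkm⟩ := Nat.exists_eq_pow_mul_and_not_dvd (orderOf_pos g).ne' p hp.out.ne_one
  refine ⟨k, Subtype.ext (hp' (g ^ p ^ k) (pow_mem hg _) ?_)⟩
  rw [orderOf_pow_of_dvd (pow_ne_zero _ hp.out.ne_zero) (hkm ▸ dvd_mul_right _ _), hkm,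
    Nat.mul_div_cancel_left _ (pow_pos hp.out.pos k)]
  exact ((Nat.Prime.coprime_iff_not_dvd hp.out).2 hm).symm

theorem exists_pow_eq_one_of_pow_mem [Finite G] {O : Subgroup G} [O.Normal] {q : ℕ}
    (hO : (Nat.card O).Coprime q) {x : G} (hx : x ^ q ∈ O) :
    ∃ k : ℕ, (x ^ k) ^ q = 1 ∧ ((x ^ k : G) : G ⧸ O) = x := by
  -- k is 0 modulo the order of O, which kills x^q, and 1 modulo q, which leaves the coset of x
  -- unchanged. So small elements of G/O lift to small elements.
  obtain ⟨k, hk0, hk1⟩ := Nat.chineseRemainder hO 0 1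
  refine ⟨k, ?_, ?_⟩
  · obtain ⟨m, rfl⟩ := (Nat.modEq_zero_iff_dvd).1 hk0
    have h1 : (x ^ q) ^ Nat.card O = 1 :=
      congrArg Subtype.val (pow_card_eq_one' (x := (⟨x ^ q, hx⟩ : O)))
    rw [pow_right_comm, pow_mul, h1, one_pow]
  · have h1 : (x : G ⧸ O) ^ q = 1 := (QuotientGroup.eq_one_iff (x ^ q)).2 hx
    have h2 : (x : G ⧸ O) ^ k = (x : G ⧸ O) ^ 1 :=
      pow_eq_pow_iff_modEq.2 (hk1.of_dvd (orderOf_dvd_of_pow_eq_one h1))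
    rwa [pow_one] at h2

/-- If `G` is `p`-solvable, the `p`-chief factors of `G` below `E` are centralized by `D`, and `E`
contains the elements of `D` of order `p` (and `4` if `p = 2`), then `D` is `p`-nilpotent. -/
theorem IsPSolvable.isPNilpotent_of_small_elements [hp : Fact p.Prime] [Finite G]
    (hG : IsPSolvable p G) {D E : Subgroup G} [hDn : D.Normal] [hEn : E.Normal]
    (hsmall : ∀ x ∈ D, x ^ p = 1 ∨ (p = 2 ∧ x ^ 4 = 1) → x ∈ E)
    (hE : ∀ K H : Subgroup G, IsChiefFactor K H → H ≤ E → ∀ n, K.relIndex H = p ^ n → ⁅H, D⁆ ≤ K) :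
    IsPNilpotent p D := by
  obtain ⟨O, ⟨hOn, hOD, hOc⟩, hmax⟩ :=
    (Set.toFinite {N : Subgroup G | N.Normal ∧ N ≤ D ∧ (Nat.card N).Coprime p}).exists_maximal
      ⟨⊥, inferInstance, bot_le, by simp⟩
  let f := QuotientGroup.mk' O
  have hf : Function.Surjective f := QuotientGroup.mk'_surjective O
  have hker : f.ker = O := QuotientGroup.ker_mk' O
  have hDf : (D.map f).Normal := hDn.map f hf
  have hEf : (E.map f).Normal := hEn.map f hf
  have hback : (D.map f).comap f = D := Subgroup.comap_map_eq_self (hker.le.trans hOD)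
  have hpg : IsPGroup p (D.map f) := by
    refine (hG.of_surjective hf).isPGroup_of_small_elements (E := E.map f) ?_ ?_ ?_
    · rintro _ ⟨x, hx, rfl⟩ hxs
      have key : ∀ q : ℕ, (Nat.card O).Coprime q → f x ^ q = 1 → (∀ z : G, z ^ q = 1 →
          z ^ p = 1 ∨ (p = 2 ∧ z ^ 4 = 1)) → f x ∈ E.map f := by
        intro q hq hxq hz
        obtain ⟨k, hk1, hk2⟩ := exists_pow_eq_one_of_pow_mem hq (x := x)
          (by rwa [← map_pow, ← MonoidHom.mem_ker, hker] at hxq)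
        exact ⟨x ^ k, hsmall _ (pow_mem hx k) (hz _ hk1), hk2⟩
      rcases hxs with h1 | ⟨h2, h1⟩
      · exact key p hOc h1 fun z hz => .inl hz
      · refine key 4 ?_ h1 fun z hz => .inr ⟨h2, hz⟩
        subst h2
        exact hOc.pow_right 2
    · intro K H hKH hH n hn
      have h1 := hKH.comap hf
      rw [← IsChiefFactor.relIndex_comap hf] at hn
      have hOK : O ≤ K.comap f := hker.ge.trans (Subgroup.ker_le_comap f K)
      have hHE : H.comap f ≤ O ⊔ E := by
        have := Subgroup.comap_mono (f := f) hH
        rwa [Subgroup.comap_map_eq, hker, sup_comm] at this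
      have h2 : ⁅H.comap f, D⁆ ≤ K.comap f := by
        have := h1.normal_bot
        -- E cannot avoid the pulled-back factor: it lies in OE and O is below its bottom, so
        -- avoidance would collapse it.
        rcases h1.inf_le_or_le_sup E with h3 | h3
        · refine absurd ?_ h1.lt.not_ge
          rw [← inf_eq_right.2 hHE, Subgroup.sup_inf_eq_of_le_of_normal (hOK.trans h1.lt.le),
            inf_comm]
          exact sup_le hOK h3
        · rw [← h3]
          exact Subgroup.sup_commutator_le (Subgroup.commutator_le_left _ _)
            ((hE _ _ (h1.inf h3) inf_le_right n (by rw [h1.relIndex_inf h3, hn])).trans inf_le_left)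
      rw [← Subgroup.map_comap_eq_self_of_surjective hf H, ← Subgroup.map_commutator,
        Subgroup.map_le_iff_le_comap]
      exact h2
    · intro N hN hND hNc
      have h1 : O ≤ N.comap f := hker.ge.trans (Subgroup.ker_le_comap f N)
      have h2 : Nat.card (N.comap f) = Nat.card O * Nat.card N := by
        rw [← Subgroup.relIndex_bot_left, ← Subgroup.relIndex_mul_relIndex ⊥ O _ bot_le h1,
          Subgroup.relIndex_bot_left]
        have := Subgroup.relIndex_ker (K := N.comap f) f
        rw [hker, Subgroup.map_comap_eq_self_of_surjective hf] at this
        rw [this]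
      have h3 : N.comap f ≤ O := hmax ⟨hN.comap f, (Subgroup.comap_mono hND).trans hback.le,
        h2 ▸ hOc.mul_left hNc⟩ h1
      rw [eq_bot_iff, ← Subgroup.map_comap_eq_self_of_surjective hf N,
        ← (Subgroup.map_eq_bot_iff O).2 hker.ge]
      exact Subgroup.map_mono h3
  obtain ⟨n, hn⟩ := IsPGroup.iff_card.1 hpg
  refine ⟨O.subgroupOf D, inferInstance, ?_, n, ?_⟩
  · rwa [Nat.card_congr (Subgroup.subgroupOfEquivOfLe hOD).toEquiv]
  · rw [← hn, ← Subgroup.relIndex_ker, hker]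
    rfl

/-! ### Derived subgroups, the `p`-Fitting series and the bound -/

theorem IsPNilpotent.of_equiv (e : G ≃* X) (h : IsPNilpotent p G) : IsPNilpotent p X := by
  obtain ⟨N, hN, hc, n, hn⟩ := h
  refine ⟨N.map e.toMonoidHom, hN.map _ e.surjective, ?_, n, ?_⟩
  · rwa [← Nat.card_congr (N.equivMapOfInjective _ e.injective).toEquiv]
  · rw [← hn]
    exact Subgroup.index_map_equiv N e

/-- G acts on a factor of order p through the automorphism group of a cyclic group, which is
abelian, so the derived subgroup acts trivially. -/
theorem IsChiefFactor.commutator_le_of_relIndex_eq_prime [hp : Fact p.Prime] {K H : Subgroup G}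
    (h : IsChiefFactor K H) (hn : K.relIndex H = p) : ⁅H, commutator G⁆ ≤ K := by
  have := h.normal_bot
  have hHn := h.normal_top
  let f := QuotientGroup.mk' K
  have hf : Function.Surjective f := QuotientGroup.mk'_surjective K
  have hker : f.ker = K := QuotientGroup.ker_mk' K
  have hV : (H.map f).Normal := hHn.map f hf
  have hcard : Nat.card (H.map f) = p := by rw [← Subgroup.relIndex_ker, hker, hn]
  have : IsCyclic (H.map f) := isCyclic_of_prime_card hcard
  let φ : G ⧸ K →* MulAut (H.map f) := MulAut.conjNormal
  let ψ : G →* (ZMod (Nat.card (H.map f)))ˣ :=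
    (IsCyclic.mulAutMulEquiv (H.map f)).toMonoidHom.comp (φ.comp f)
  have hψ := Abelianization.commutator_subset_ker ψ
  rw [Subgroup.commutator_le]
  intro x hx y hy
  have h1 : φ (f y) = 1 := (IsCyclic.mulAutMulEquiv (H.map f)).injective
    ((hψ hy : ψ y = 1).trans (map_one _).symm)
  have h2 := congrArg Subtype.val (DFunLike.congr_fun h1 ⟨f x, x, hx, rfl⟩)
  rw [MulAut.conjNormal_apply, mul_inv_eq_iff_eq_mul] at h2
  rw [← hker, MonoidHom.mem_ker, map_commutatorElement, commutatorElement_eq_one_iff_mul_comm]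
  exact h2.symm

theorem IsPSupersolvable.isPNilpotent_commutator [hp : Fact p.Prime] [Finite G]
    (hG : IsPSupersolvable p G) : IsPNilpotent p (commutator G) := by
  refine hG.isPSolvable.isPNilpotent_of_small_elements (E := ⊤) (fun _ _ _ => trivial) ?_
  intro K H h _ n hn
  refine h.commutator_le_of_relIndex_eq_prime (p := p) ((hG K H h).resolve_right fun hc => ?_)
  rw [hn] at hc
  rcases Nat.eq_zero_or_pos n with h0 | h0
  · rw [h0, pow_zero, Subgroup.relIndex_eq_one] at hn
    exact h.lt.not_ge hn
  · exact hp.out.one_lt.ne' ((Nat.coprime_self p).1 ((Nat.coprime_pow_left_iff h0 p p).1 hc))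

theorem le_pFitting {N : Subgroup G} (hN : N.Normal) (h : IsPNilpotent p N) : N ≤ pFitting p G :=
  le_sSup ⟨hN, h⟩

instance pFittingSeries_normal (i : ℕ) : (pFittingSeries p G i).Normal := (pFittingSeriesAux p G i).2

theorem pFittingSeries_succ (i : ℕ) : pFittingSeries p G (i + 1) =
    (pFitting p (G ⧸ pFittingSeries p G i)).comap (QuotientGroup.mk' (pFittingSeries p G i)) := rfl

theorem le_pFittingSeries_one {N : Subgroup G} (hN : N.Normal) (h : IsPNilpotent p N) :
    N ≤ pFittingSeries p G 1 := by
  have hinj : Function.Injective (QuotientGroup.mk' (⊥ : Subgroup G)) := by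
    rw [← MonoidHom.ker_eq_bot_iff, QuotientGroup.ker_mk']
  have h0 : pFittingSeries p G 1 =
    (pFitting p (G ⧸ (⊥ : Subgroup G))).comap (QuotientGroup.mk' ⊥) := rfl
  rw [h0, ← Subgroup.map_le_iff_le_comap]
  exact le_pFitting (hN.map _ (QuotientGroup.mk'_surjective _))
    (h.of_equiv (N.equivMapOfInjective _ hinj))

theorem IsPSolvable.pFitting_eq_top_of_commutator_eq_bot [hp : Fact p.Prime] [Finite G]
    (hG : IsPSolvable p G) (hc : commutator G = ⊥) : pFitting p G = ⊤ := by
  refine top_le_iff.1 (le_pFitting inferInstance ?_)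
  refine hG.isPNilpotent_of_small_elements (E := ⊤) (fun _ _ _ => trivial) fun K H _ _ _ _ => ?_
  refine le_trans ?_ bot_le
  rw [← hc]
  exact Subgroup.commutator_mono le_top le_rfl

end

theorem theorem5p5 (p : ℕ) (hp : p.Prime) (G : Type u) [Group G] [Finite G]
    (hG : IsPSolvable p G)
    (h : ∀ x : G, orderOf x = p ∨ (p = 2 ∧ orderOf x = 4) →
      x ∈ (pSupersolvableClass p).hyperNorm G) :
    pFittingLength p G ≤ 3 := by
  have : Fact p.Prime := ⟨hp⟩
  have hres : IsPNilpotent p ((pSupersolvableClass p).residual G) := by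
    refine hG.isPNilpotent_of_small_elements (E := (pSupersolvableClass p).hyperNorm G) ?_
      fun K H hKH hH n hn => hG.commutator_residual_le hKH hn hH
    intro x _ hx
    -- The criterion speaks of powers equal to 1, the hypothesis of exact orders; the identity and,
    -- for p = 2, involutions have to be split off.
    by_cases hx1 : x = 1
    · exact hx1 ▸ one_mem _
    by_cases hxp : x ^ p = 1
    · exact h x (.inl (orderOf_eq_prime hxp hx1))
    · obtain ⟨h2, h4⟩ := hx.resolve_left hxp
      subst h2
      exact h x (.inr ⟨rfl, orderOf_eq_prime_pow (p := 2) (n := 1) (by simpa using hxp) h4⟩)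
  have h1 := le_pFittingSeries_one inferInstance hres
  have h2 : commutator G ≤ pFittingSeries p G 2 := by
    have hs : IsPSupersolvable p (G ⧸ pFittingSeries p G 1) := by
      rwa [← pSupersolvableClass_residual_le_ker_iff (QuotientGroup.mk'_surjective _),
        QuotientGroup.ker_mk']
    rw [pFittingSeries_succ, ← Subgroup.map_le_iff_le_comap]
    refine le_trans ?_ (le_pFitting inferInstance hs.isPNilpotent_commutator)
    rw [commutator_def, Subgroup.map_commutator, commutator_def]
    exact Subgroup.commutator_mono le_top le_top
  have h3 : pFittingSeries p G 3 = ⊤ := by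
    have hsurj := QuotientGroup.mk'_surjective (pFittingSeries p G 2)
    rw [pFittingSeries_succ, (hG.of_surjective hsurj).pFitting_eq_top_of_commutator_eq_bot,
      Subgroup.comap_top]
    rw [commutator_def, ← Subgroup.map_top_of_surjective _ hsurj, ← Subgroup.map_commutator,
      Subgroup.map_eq_bot_iff, QuotientGroup.ker_mk', ← commutator_def]
    exact h2
  exact iInf₂_le (3 : ℕ) ⟨three_pos, h3⟩
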